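/- There is a finite-time algorithm that, given an element $g$ of a Garside group, computes its stable super summit set $[g]^{\mathrm{St}}$. Here a monoid is *atomic* if it is generated by its atoms (the elements $a\ne 1$ such that $a=bc$ implies $b=1$ or $c=1$) and, for each element, the lengths of its expressions as a product of atoms are bounded. Write $a\le_L b$ if $ac=b$, and $a\le_R b$ if $ca=b$, for some $c$. A *Garside monoid* with *Garside element* $\Delta$ is a finitely generated, left and right cancellative, atomic monoid $M$ for which $(M,\le_L)$ and $(M,\le_R)$ are lattices, such that $a\le_L\Delta\iff a\le_R\Delta$ for all $a\in M$, and such that the set $\mathcal D=\{a\in M: a\le_L\Delta\}$ of *simple elements* (which is finite) generates $M$. A *Garside group* $G$ is the group of fractions of a Garside monoid $G^+\subseteq G$; for $g,h\in G$ write $g\le_L h$ if $gc=h$ for some $c\in G^+$. Put $\inf(g)=\max\{r\in\mathbb Z:\Delta^r\le_L g\}$ and $\sup(g)=\min\{r\in\mathbb Z: g\le_L\Delta^r\}$ (with $\inf=\sup=0$ if $G$ is trivial), and $[g]=\{c^{-1}gc: c\in G\}$. Then $$[g]^S=\Bigl\{h\in[g]:\inf(h)=\max_{x\in[g]}\inf(x),\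 \sup(h)=\min_{x\in[g]}\sup(x)\Bigr\},\qquad [g]^{\mathrm{St}}=\{h\in[g]^S: h^n\in[g^n]^S\text{ for all }n\ge 1\}.$$ Precisely: there is one partial recursive function $A$, the same for all Garside groups, with the following property. Let $G$ be a Garside group, let $s_0,\dots,s_{k-1}$ list its simple elements without repetition, let $T$ be a finite list of triples of natural numbers in which exactly the triples $(i,j,l)$ with $i,j,l<k$ and $s_is_j=s_l$ in $G$ occur, and let $w$ be a word in the letters $s_i^{\pm1}$ that represents $g\in G$. Then $A$ halts on the input $(T,w)$ and returns a finite list of words in the letters $s_i^{\pm1}$ that represent pairwise different elements of $G$, the set of these elements being $[g]^{\mathrm{St}}$. -/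

import Mathlib

namespace Garside

/-! ### Garside monoids -/

/-- Left divisibility `a ≤_L b`: `a c = b` for some `c`. -/
def LeL {M : Type*} [Monoid M] (a b : M) : Prop := ∃ c, a * c = b

/-- Right divisibility `a ≤_R b`: `c a = b` for some `c`. -/
def LeR {M : Type*} [Monoid M] (a b : M) : Prop := ∃ c, c * a = b

/-- The atoms of a monoid: the elements `a ≠ 1` that are not a product of two
elements different from `1`. -/
def atoms (M : Type*) [Monoid M] : Set M :=
  {a | a ≠ 1 ∧ ∀ b c : M, a = b * c → b = 1 ∨ c = 1}

/-- A monoid is atomic if its atoms generate it and, for each `a`, the lengths of the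
expressions of `a` as a product of atoms are bounded (that is, `‖a‖ < ∞`). -/
structure IsAtomic (M : Type*) [Monoid M] : Prop where
  closure_atoms : Submonoid.closure (atoms M) = ⊤
  norm_finite : ∀ a : M, ∃ n : ℕ, ∀ l : List M,
    (∀ x ∈ l, x ∈ atoms M) → l.prod = a → l.length ≤ n

/-- Every two elements have a greatest lower bound and a least upper bound for `r`. It is used
for the divisibility relations of a cancellative atomic monoid, which are partial orders. -/
def IsLatticeRel {M : Type*} (r : M → M → Prop) : Prop :=
  ∀ a b : M,
    (∃ d, r d a ∧ r d b ∧ ∀ c, r c a → r c b → r c d) ∧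
    (∃ m, r a m ∧ r b m ∧ ∀ c, r a c → r b c → r m c)

/-- `M` is a Garside monoid with Garside element `Δ`. -/
structure IsGarsideMonoid (M : Type*) [Monoid M] (Δ : M) : Prop where
  atomic : IsAtomic M
  fg : Monoid.FG M
  cancel : IsCancelMul M
  latticeL : IsLatticeRel (LeL : M → M → Prop)
  latticeR : IsLatticeRel (LeR : M → M → Prop)
  leL_iff_leR : ∀ a : M, LeL a Δ ↔ LeR a Δ
  closure_simple : Submonoid.closure {a : M | LeL a Δ} = ⊤

/-! ### Garside groups -/

/-- `G` is a Garside group with positive monoid `P` and Garside element `Δ`: the submonoid `P`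
is a Garside monoid with Garside element `Δ`, and `G` is its group of fractions. -/
structure IsGarsideGroup {G : Type*} [Group G] (P : Submonoid G) (Δ : P) : Prop where
  garsideMonoid : IsGarsideMonoid P Δ
  fractions : ∀ g : G, ∃ a ∈ P, ∃ b ∈ P, g = a * b⁻¹

/-- The set `𝒟` of simple elements: the positive elements `a` with `a ≤_L Δ` in the positive
monoid, seen in `G`. -/
def simples {G : Type*} [Group G] (P : Submonoid G) (Δ : P) : Set G :=
  {x | ∃ a : P, LeL a Δ ∧ (a : G) = x}

/-- The order `≤_L` on the group: `g c = h` for some positive `c`. -/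
def GroupLeL {G : Type*} [Group G] (P : Submonoid G) (g h : G) : Prop :=
  ∃ c ∈ P, g * c = h

/-- `inf g = max {r ∈ ℤ : Δ ^ r ≤_L g}`. The maximum exists unless `G` is trivial, where the
value is `0`. -/
noncomputable def inf {G : Type*} [Group G] (P : Submonoid G) (Δ : P) (g : G) : ℤ :=
  sSup {r : ℤ | GroupLeL P ((Δ : G) ^ r) g}

/-- `sup g = min {r ∈ ℤ : g ≤_L Δ ^ r}`. The minimum exists unless `G` is trivial, where the
value is `0`. -/
noncomputable def sup {G : Type*} [Group G] (P : Submonoid G) (Δ : P) (g : G) : ℤ :=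
  sInf {r : ℤ | GroupLeL P g ((Δ : G) ^ r)}

/-- The conjugacy class `[g] = {c⁻¹ g c : c ∈ G}`. -/
def conjClass {G : Type*} [Group G] (g : G) : Set G :=
  {h | ∃ c : G, h = c⁻¹ * g * c}

/-- The super summit set `[g]^S`: the `h ∈ [g]` for which `inf h` is the maximum of `inf` on
`[g]` (the number `inf_s g`) and `sup h` is the minimum of `sup` on `[g]` (the number
`sup_s g`). -/
def superSummitSet {G : Type*} [Group G] (P : Submonoid G) (Δ : P) (g : G) : Set G :=
  {h | h ∈ conjClass g ∧
    IsGreatest (inf P Δ '' conjClass g) (inf P Δ h) ∧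
    IsLeast (sup P Δ '' conjClass g) (sup P Δ h)}

/-- The stable super summit set `[g]^St`. -/
def stableSuperSummitSet {G : Type*} [Group G] (P : Submonoid G) (Δ : P) (g : G) : Set G :=
  {h | h ∈ superSummitSet P Δ g ∧ ∀ n : ℕ, 1 ≤ n → h ^ n ∈ superSummitSet P Δ (g ^ n)}

/-! ### Finite descriptions of Garside groups and of their elements -/

/-- The list `s` enumerates the simple elements, each of them once. -/
def IsSimpleEnumeration {G : Type*} [Group G] (P : Submonoid G) (Δ : P) (s : List G) : Prop :=
  s.Nodup ∧ ∀ x : G, x ∈ s ↔ x ∈ simples P Δ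

/-- `T` is the partial multiplication table of the elements listed in `s`: it contains the
triple `(i, j, k)` exactly if `i`, `j`, `k` are positions in `s` and `s_i s_j = s_k`. -/
def IsProductTable {G : Type*} [Group G] (s : List G) (T : List (ℕ × ℕ × ℕ)) : Prop :=
  ∀ i j k : ℕ, (i, j, k) ∈ T ↔
    ∃ a b c : G, s[i]? = some a ∧ s[j]? = some b ∧ s[k]? = some c ∧ a * b = c

/-- A word is a list of letters; the letter `(i, true)` stands for the `i`-th listed element,
`(i, false)` for its inverse. -/
abbrev Word : Type := List (ℕ × Bool)

/-- All letters of the word `w` refer to positions in `s`. -/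
def IsWordOver {G : Type*} (s : List G) (w : Word) : Prop :=
  ∀ p ∈ w, p.1 < s.length

/-- The element of `G` represented by a word over `s`. (The default value `1` is not used for
words with `IsWordOver s w`.) -/
def wordEval {G : Type*} [Group G] (s : List G) (w : Word) : G :=
  (w.map fun p => if p.2 then s.getD p.1 1 else (s.getD p.1 1)⁻¹).prod

end Garside

namespace Garside

/-! ### Basic properties of Garside groups -/

/-! The set is computable because the condition on all powers reduces to finitely many exponents,
and for each exponent a finite search of known size suffices.

Reduction. Inversion exchanges inf and sup, so only lower bounds Δ^p ≤ g^q matter. Given one, the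
meets c_j of the elements g^i Δ^⌊(j - ip)/q⌋, 0 ≤ i < q, increase with j and satisfy c_{j+q} = c_j Δ
and c_{j+np} ≤ g^n c_j (`exists_ladder`). Conjugating g^n by c_0 gives inf_s(g^n) ≥ ⌊np/q⌋
(`InfAtLeast.floor`). If q is at least the number of simple elements, the q + 1 simple elements
c_0⁻¹ c_j, 0 ≤ j ≤ q, cannot be distinct, so c_{k-1} = c_k for some k. When p, q are coprime and np
= mq - 1, this coincidence improves the bound to inf_s(g^n) ≥ m with n < q. Hence every slope p/q is
dominated by one whose denominator is at most the number of simple elements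
(`InfAtLeast.exists_small`), and Euclidean division passes from small exponents to all
(`groupLeL_pow_of_infAtLeast`).

Search. The elements between Δ^(-R) and Δ^R are finite in number. Conjugate ones are joined inside
this set by conjugations with simple elements and their inverses (`exists_short_conj`), and for g in
this set, inf can be maximised over [g] without leaving it (`InfAtLeast.exists_le`). Positivity of a
word is read off the table, because division by a simple element proceeds letter by letter through
common multiples that stay simple (`exists_simple_complement`, `isPos_iff`). All searches run over
lists of words of precomputed length, so the algorithm is even primitive recursive. -/

/-- An atomic monoid carries a superadditive length that is positive away from `1`. -/
theorem IsAtomic.exists_norm {M : Type*} [Monoid M] (hM : IsAtomic M) :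
    ∃ ν : M → ℕ, (∀ a b, ν a + ν b ≤ ν (a * b)) ∧ ∀ a, a ≠ 1 → 1 ≤ ν a := by
  choose n hn using hM.norm_finite
  let S : M → Set ℕ := fun a =>
    {k | ∃ l : List M, (∀ x ∈ l, x ∈ atoms M) ∧ l.prod = a ∧ l.length = k}
  have hbdd : ∀ a, BddAbove (S a) := fun a => ⟨n a, by
    rintro _ ⟨l, h1, h2, rfl⟩
    exact hn a l h1 h2⟩
  have hne : ∀ a, (S a).Nonempty := fun a => by
    have ha : a ∈ Submonoid.closure (atoms M) := by rw [hM.closure_atoms]; trivial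
    obtain ⟨l, h1, h2⟩ := Submonoid.exists_list_of_mem_closure ha
    exact ⟨_, l, h1, h2, rfl⟩
  refine ⟨fun a => sSup (S a), fun a b => ?_, fun a ha => ?_⟩
  · obtain ⟨l, h1, h2, h3⟩ := Nat.sSup_mem (hne a) (hbdd a)
    obtain ⟨l', h1', h2', h3'⟩ := Nat.sSup_mem (hne b) (hbdd b)
    refine le_csSup (hbdd _) ⟨l ++ l', ?_, by simp [h2, h2'], by simp [h3, h3']⟩
    intro x hx
    rcases List.mem_append.1 hx with hx | hx
    exacts [h1 x hx, h1' x hx]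
  · obtain ⟨l, h1, h2, h3⟩ := Nat.sSup_mem (hne a) (hbdd a)
    simp only
    rw [← h3]
    rcases l with _ | ⟨x, l⟩
    · exact absurd h2.symm ha
    · simp

section GarsideGroup

variable {G : Type*} [Group G] {P : Submonoid G} {Δ : P}

theorem groupLeL_iff {x y : G} : GroupLeL P x y ↔ x⁻¹ * y ∈ P :=
  ⟨fun ⟨c, hc, h⟩ => by simpa [← h] using hc, fun h => ⟨_, h, by simp⟩⟩

theorem GroupLeL.refl (x : G) : GroupLeL P x x := ⟨1, P.one_mem, mul_one x⟩

theorem GroupLeL.trans {x y z : G} : GroupLeL P x y → GroupLeL P y z → GroupLeL P x z := by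
  rintro ⟨c, hc, rfl⟩ ⟨d, hd, rfl⟩
  exact ⟨c * d, P.mul_mem hc hd, (mul_assoc _ _ _).symm⟩

theorem one_groupLeL_iff {x : G} : GroupLeL P 1 x ↔ x ∈ P := by simp [groupLeL_iff]

theorem GroupLeL.mul_left (g : G) {x y : G} (h : GroupLeL P x y) : GroupLeL P (g * x) (g * y) := by
  rw [groupLeL_iff] at *
  simpa [mul_assoc] using h

theorem mul_groupLeL_iff {g x y : G} : GroupLeL P (g * x) y ↔ GroupLeL P x (g⁻¹ * y) := by
  simp [groupLeL_iff, mul_assoc]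

theorem mem_simples {x : G} : x ∈ simples P Δ ↔ x ∈ P ∧ x⁻¹ * Δ ∈ P := by
  constructor
  · rintro ⟨a, ⟨c, hc⟩, rfl⟩
    refine ⟨a.2, ?_⟩
    rw [← hc]
    simp
  · rintro ⟨h1, h2⟩
    exact ⟨⟨x, h1⟩, ⟨⟨_, h2⟩, by ext; simp⟩, rfl⟩

theorem one_mem_simples : (1 : G) ∈ simples P Δ := mem_simples.2 ⟨P.one_mem, by simp⟩

theorem delta_mem_simples : (Δ : G) ∈ simples P Δ := mem_simples.2 ⟨Δ.2, by simp [P.one_mem]⟩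

theorem delta_zpow_groupLeL {i j : ℤ} (h : i ≤ j) : GroupLeL P ((Δ : G) ^ i) ((Δ : G) ^ j) := by
  rw [groupLeL_iff, ← zpow_neg, ← zpow_add]
  obtain ⟨n, hn⟩ := Int.le.dest h
  rw [show -i + j = (n : ℤ) by omega, zpow_natCast]
  exact P.pow_mem Δ.2 n

variable (hG : IsGarsideGroup P Δ)
include hG

theorem mem_simples' {x : G} : x ∈ simples P Δ ↔ x ∈ P ∧ Δ * x⁻¹ ∈ P := by
  constructor
  · rintro ⟨a, ha, rfl⟩
    obtain ⟨c, hc⟩ := (hG.garsideMonoid.leL_iff_leR a).1 ha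
    refine ⟨a.2, ?_⟩
    rw [← hc]
    simp
  · rintro ⟨h1, h2⟩
    refine ⟨⟨x, h1⟩, (hG.garsideMonoid.leL_iff_leR _).2 ⟨⟨_, h2⟩, by ext; simp⟩, rfl⟩

theorem star_mem_simples {x : G} (hx : x ∈ simples P Δ) : x⁻¹ * Δ ∈ simples P Δ := by
  rw [mem_simples' hG]
  exact ⟨(mem_simples.1 hx).2, by simpa using (mem_simples.1 hx).1⟩

theorem star_mem_simples' {x : G} (hx : x ∈ simples P Δ) : Δ * x⁻¹ ∈ simples P Δ := by
  rw [mem_simples]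
  exact ⟨((mem_simples' hG).1 hx).2, by simpa using (mem_simples.1 hx).1⟩

theorem closure_simples : Submonoid.closure (simples P Δ) = P := by
  have h := congrArg (Submonoid.map P.subtype) hG.garsideMonoid.closure_simple
  rw [MonoidHom.map_mclosure, ← MonoidHom.mrange_eq_map, Submonoid.mrange_subtype] at h
  exact h

theorem exists_simple_list {a : G} (ha : a ∈ P) :
    ∃ l : List G, (∀ x ∈ l, x ∈ simples P Δ) ∧ l.prod = a := by
  rw [← closure_simples hG] at ha
  exact Submonoid.exists_list_of_mem_closure ha

/-- The complement x ↦ x⁻¹Δ preserves simple elements, and applied twice it is conjugation by Δ. -/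
theorem conj_delta_mem {a : G} (ha : a ∈ P) : (Δ : G)⁻¹ * a * Δ ∈ P := by
  rw [← closure_simples hG] at ha
  induction ha using Submonoid.closure_induction with
  | mem x hx =>
    have := star_mem_simples hG (star_mem_simples hG hx)
    simpa [mul_assoc] using (mem_simples.1 this).1
  | one => simp [P.one_mem]
  | mul x y _ _ hx hy => simpa [mul_assoc] using P.mul_mem hx hy

theorem conj_delta_mem' {a : G} (ha : a ∈ P) : (Δ : G) * a * (Δ : G)⁻¹ ∈ P := by
  rw [← closure_simples hG] at ha
  induction ha using Submonoid.closure_induction with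
  | mem x hx =>
    have := star_mem_simples' hG (star_mem_simples' hG hx)
    simpa [mul_assoc] using (mem_simples.1 this).1
  | one => simp [P.one_mem]
  | mul x y _ _ hx hy => simpa [mul_assoc] using P.mul_mem hx hy

theorem conj_zpow_mem {a : G} (ha : a ∈ P) (k : ℤ) : (Δ : G) ^ (-k) * a * (Δ : G) ^ k ∈ P := by
  induction k with
  | zero => simpa using ha
  | succ n ih =>
    have := conj_delta_mem hG ih
    rw [zpow_add_one, neg_add, add_comm, zpow_add, zpow_neg_one]
    simpa [mul_assoc] using this
  | pred n ih =>
    have := conj_delta_mem' hG ih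
    rw [zpow_sub_one, show -(-(n : ℤ) - 1) = 1 + -(-(n : ℤ)) by ring, zpow_add, zpow_one]
    simpa [mul_assoc] using this

theorem conj_zpow_mem_iff {a : G} (k : ℤ) : (Δ : G) ^ (-k) * a * (Δ : G) ^ k ∈ P ↔ a ∈ P := by
  refine ⟨fun h => ?_, fun h => conj_zpow_mem hG h k⟩
  simpa [mul_assoc] using conj_zpow_mem hG h (-k)

/-- Left translations always preserve the order; right translation by a power of Δ does too, because
conjugation by Δ preserves the positive monoid. -/
theorem mul_zpow_groupLeL_iff {x y : G} (k : ℤ) :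
    GroupLeL P (x * (Δ : G) ^ k) (y * (Δ : G) ^ k) ↔ GroupLeL P x y := by
  rw [groupLeL_iff, groupLeL_iff, ← conj_zpow_mem_iff hG (a := x⁻¹ * y) k]
  simp [mul_assoc]

theorem GroupLeL.mul_zpow {x y : G} (h : GroupLeL P x y) (k : ℤ) :
    GroupLeL P (x * (Δ : G) ^ k) (y * (Δ : G) ^ k) := (mul_zpow_groupLeL_iff hG k).2 h

theorem groupLeL_mul {x y : G} {a b : ℤ} (hx : GroupLeL P ((Δ : G) ^ a) x)
    (hy : GroupLeL P ((Δ : G) ^ b) y) : GroupLeL P ((Δ : G) ^ (a + b)) (x * y) := by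
  rw [zpow_add]
  exact (hx.mul_zpow hG b).trans (hy.mul_left x)

theorem mul_groupLeL {x y : G} {a b : ℤ} (hx : GroupLeL P x ((Δ : G) ^ a))
    (hy : GroupLeL P y ((Δ : G) ^ b)) : GroupLeL P (x * y) ((Δ : G) ^ (a + b)) := by
  rw [zpow_add]
  exact (hy.mul_left x).trans (hx.mul_zpow hG b)

/-- This turns every statement about sup into one about inf of the inverse. -/
theorem groupLeL_inv_iff {x : G} {a : ℤ} :
    GroupLeL P ((Δ : G) ^ (-a)) x⁻¹ ↔ GroupLeL P x ((Δ : G) ^ a) := by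
  rw [groupLeL_iff, groupLeL_iff, ← conj_zpow_mem_iff hG a]
  simp

/-- Superadditivity gives length 0 to the identity, whereas a nontrivial unit and its inverse would
contribute at least 1. -/
theorem eq_one_of_inv_mem {a : G} (ha : a ∈ P) (ha' : a⁻¹ ∈ P) : a = 1 := by
  obtain ⟨ν, h1, h2⟩ := hG.garsideMonoid.atomic.exists_norm
  by_contra hne
  have h3 := h1 ⟨a, ha⟩ ⟨a⁻¹, ha'⟩
  have h4 := h2 ⟨a, ha⟩ (by simpa [Subtype.ext_iff] using hne)
  have h5 : (⟨a, ha⟩ : P) * ⟨a⁻¹, ha'⟩ = 1 := by ext; simp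
  have h6 := h1 1 1
  rw [h5] at h3
  rw [mul_one] at h6
  omega

theorem GroupLeL.antisymm {x y : G} (h : GroupLeL P x y) (h' : GroupLeL P y x) : x = y := by
  rw [groupLeL_iff] at h h'
  have := eq_one_of_inv_mem hG h (by simpa using h')
  exact (inv_mul_eq_one.1 this)

theorem exists_le_pow_of_mem {a : G} (ha : a ∈ P) : ∃ m : ℕ, GroupLeL P a ((Δ : G) ^ m) := by
  rw [← closure_simples hG] at ha
  induction ha using Submonoid.closure_induction with
  | mem x hx => exact ⟨1, groupLeL_iff.2 (by simpa using (mem_simples.1 hx).2)⟩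
  | one => exact ⟨0, by simpa using GroupLeL.refl 1⟩
  | mul x y _ _ hx hy =>
    obtain ⟨m, hm⟩ := hx
    obtain ⟨n, hn⟩ := hy
    refine ⟨m + n, ?_⟩
    have := mul_groupLeL hG (a := m) (b := n) (by simpa using hm) (by simpa using hn)
    exact_mod_cast this

theorem exists_zpow_le (g : G) : ∃ m : ℕ, GroupLeL P ((Δ : G) ^ (-(m : ℤ))) g := by
  obtain ⟨a, ha, b, hb, rfl⟩ := hG.fractions g
  obtain ⟨m, hm⟩ := exists_le_pow_of_mem hG hb
  refine ⟨m, ?_⟩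
  have h1 : GroupLeL P ((Δ : G) ^ (-(m : ℤ))) b⁻¹ := (groupLeL_inv_iff hG).2 (by simpa using hm)
  have h0 : GroupLeL P ((Δ : G) ^ (0 : ℤ)) a := by simpa [one_groupLeL_iff] using ha
  simpa using groupLeL_mul hG h0 h1

theorem exists_zpow_le_of_le (g : G) :
    ∃ m : ℕ, ∀ k : ℤ, m ≤ k → GroupLeL P ((Δ : G) ^ (-k)) g := by
  obtain ⟨m, hm⟩ := exists_zpow_le hG g
  exact ⟨m, fun k hk => (delta_zpow_groupLeL (by omega)).trans hm⟩

theorem exists_le_zpow (g : G) : ∃ m : ℕ, GroupLeL P g ((Δ : G) ^ m) := by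
  obtain ⟨m, hm⟩ := exists_zpow_le hG g⁻¹
  exact ⟨m, by simpa using (groupLeL_inv_iff hG).1 hm⟩

/-- The order `≤_L` on the group has meets. -/
theorem exists_meet (x y : G) :
    ∃ m, ∀ w, GroupLeL P w m ↔ GroupLeL P w x ∧ GroupLeL P w y := by
  -- Above a common lower bound `z`, translation by z⁻¹ reduces meets to those of the positive
  -- monoid.
  have key : ∀ z, GroupLeL P z x → GroupLeL P z y → ∃ m, GroupLeL P m x ∧ GroupLeL P m y ∧
      GroupLeL P z m ∧ ∀ w, GroupLeL P z w → GroupLeL P w x → GroupLeL P w y → GroupLeL P w m := by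
    rintro z ⟨a, ha, rfl⟩ ⟨b, hb, rfl⟩
    obtain ⟨⟨d, ⟨u, hu⟩, ⟨v, hv⟩, h3⟩, -⟩ := hG.garsideMonoid.latticeL ⟨a, ha⟩ ⟨b, hb⟩
    refine ⟨z * d, ⟨u, u.2, ?_⟩, ⟨v, v.2, ?_⟩, ⟨d, d.2, rfl⟩, ?_⟩
    · rw [mul_assoc]; congr 1; simpa using congrArg Subtype.val hu
    · rw [mul_assoc]; congr 1; simpa using congrArg Subtype.val hv
    · rintro _ ⟨c, hc, rfl⟩ ⟨c1, hc1, h4⟩ ⟨c2, hc2, h5⟩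
      rw [mul_assoc, mul_right_inj] at h4 h5
      obtain ⟨e, he⟩ := h3 ⟨c, hc⟩ ⟨⟨c1, hc1⟩, Subtype.ext h4⟩ ⟨⟨c2, hc2⟩, Subtype.ext h5⟩
      refine ⟨e, e.2, ?_⟩
      rw [mul_assoc]; congr 1; simpa using congrArg Subtype.val he
  obtain ⟨m1, h1⟩ := exists_zpow_le_of_le hG x
  obtain ⟨m2, h2⟩ := exists_zpow_le_of_le hG y
  obtain ⟨m, ha, hb, hc, hd⟩ := key _ (h1 (max m1 m2) (by simp)) (h2 (max m1 m2) (by simp))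
  refine ⟨m, fun w => ⟨fun h => ⟨h.trans ha, h.trans hb⟩, fun ⟨hx, hy⟩ => ?_⟩⟩
  -- An arbitrary `w` need not lie above the chosen lower bound, so a lower one that is also below
  -- `w` is used; the meet relative to it is the same element.
  obtain ⟨m3, h3⟩ := exists_zpow_le_of_le hG w
  have hle : GroupLeL P ((Δ : G) ^ (-(max (max m1 m2) m3 : ℤ)))
      ((Δ : G) ^ (-(max m1 m2 : ℤ))) :=
    delta_zpow_groupLeL (neg_le_neg (le_max_left _ _))
  obtain ⟨n, ha', hb', hc', hd'⟩ := key _ (h1 (max (max m1 m2) m3) (by simp))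
    (h2 (max (max m1 m2) m3) (by simp))
  have hmn : GroupLeL P m n := hd' m (hle.trans hc) ha hb
  have hnm : GroupLeL P n m := hd n (hc.trans hmn) ha' hb'
  exact (hd' w (h3 _ (by simp)) hx hy).trans hnm

theorem exists_finite_meet (f : ℕ → G) (q : ℕ) (hq : 1 ≤ q) :
    ∃ m, ∀ w, GroupLeL P w m ↔ ∀ i < q, GroupLeL P w (f i) := by
  induction q, hq using Nat.le_induction with
  | base => exact ⟨f 0, fun w => by simp⟩
  | succ n _ ih =>
    obtain ⟨m, hm⟩ := ih
    obtain ⟨m', hm'⟩ := exists_meet hG m (f n)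
    refine ⟨m', fun w => ?_⟩
    rw [hm', hm, Nat.forall_lt_succ_right]

end GarsideGroup

/-! ### Lower bounds for inf on powers of an element -/

section Powers

variable {G : Type*} [Group G] {P : Submonoid G} {Δ : P}

theorem self_mem_conjClass (g : G) : g ∈ conjClass g := ⟨1, by simp⟩

theorem mem_conjClass_trans {g h k : G} (hh : h ∈ conjClass g) (hk : k ∈ conjClass h) :
    k ∈ conjClass g := by
  obtain ⟨c, rfl⟩ := hh
  obtain ⟨d, rfl⟩ := hk
  exact ⟨c * d, by group⟩

theorem conj_pow_eq (c g : G) (n : ℕ) : (c⁻¹ * g * c) ^ n = c⁻¹ * g ^ n * c := by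
  simpa using conj_pow (a := c⁻¹) (b := g) (i := n)

theorem pow_mem_conjClass {g h : G} (hh : h ∈ conjClass g) (n : ℕ) : h ^ n ∈ conjClass (g ^ n) := by
  obtain ⟨c, rfl⟩ := hh
  exact ⟨c, conj_pow_eq c g n⟩

theorem inv_mem_conjClass {g h : G} (hh : h ∈ conjClass g) : h⁻¹ ∈ conjClass g⁻¹ := by
  obtain ⟨c, rfl⟩ := hh
  exact ⟨c, by group⟩

variable (P Δ) in
/-- Some conjugate of `g` is at least `Δ ^ r`, that is, `r ≤ inf_s g`. -/
def InfAtLeast (g : G) (r : ℤ) : Prop := ∃ x ∈ conjClass g, GroupLeL P ((Δ : G) ^ r) x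

theorem InfAtLeast.of_conj {g h : G} {r : ℤ} (hh : h ∈ conjClass g) (H : InfAtLeast P Δ h r) :
    InfAtLeast P Δ g r := by
  obtain ⟨x, hx, hr⟩ := H
  exact ⟨x, mem_conjClass_trans hh hx, hr⟩

theorem infAtLeast_of_le {g c : G} {r : ℤ} (h : GroupLeL P (c * (Δ : G) ^ r) (g * c)) :
    InfAtLeast P Δ g r :=
  ⟨c⁻¹ * g * c, ⟨c, rfl⟩, by simpa [mul_groupLeL_iff, mul_assoc] using h⟩

variable (hG : IsGarsideGroup P Δ)
include hG

/-- If `Δ ^ p ≤_L g ^ q`, then the meets `c j` of the elements `g ^ i * Δ ^ ⌊(j - i p) / q⌋`,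
`0 ≤ i < q`, interpolate between `c 0` and `c 0 * Δ`, and `g` raises the index by at least `p`. -/
theorem exists_ladder {g : G} {q : ℕ} (hq : 1 ≤ q) {p : ℤ}
    (h : GroupLeL P ((Δ : G) ^ p) (g ^ q)) :
    ∃ c : ℤ → G, (∀ j k : ℤ, c (j + k * q) = c j * (Δ : G) ^ k) ∧
      (∀ i j, i ≤ j → GroupLeL P (c i) (c j)) ∧
      ∀ (n : ℕ) (j : ℤ), GroupLeL P (c (j + n * p)) (g ^ n * c j) := by
  have hq0 : (q : ℤ) ≠ 0 := by omega
  choose c hc using fun j : ℤ =>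
    exists_finite_meet hG (fun i => g ^ i * (Δ : G) ^ ((j - i * p) / (q : ℤ))) q hq
  have hle : ∀ j : ℤ, ∀ i < q, GroupLeL P (c j) (g ^ i * (Δ : G) ^ ((j - i * p) / (q : ℤ))) :=
    fun j => (hc j _).1 (GroupLeL.refl _)
  have hmono : ∀ i j, i ≤ j → GroupLeL P (c i) (c j) := fun i j hij =>
    (hc j _).2 fun k hk => (hle i k hk).trans <| GroupLeL.mul_left _ <|
      delta_zpow_groupLeL <| Int.ediv_le_ediv (by omega) (by omega)
  -- Multiplication by `g` turns the i-th term of the meet `c j` into the (i+1)-st term of `c (j +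
  -- p)`; the last term wraps round to the 0-th by Δ^p ≤ g^q.
  have hstep : ∀ j : ℤ, GroupLeL P (c (j + p)) (g * c j) := by
    intro j
    rw [← inv_inv g, ← mul_groupLeL_iff, hc]
    intro i hi
    rw [mul_groupLeL_iff, inv_inv, ← mul_assoc, ← pow_succ']
    rcases Nat.lt_or_ge (i + 1) q with hi' | hi'
    · refine (hle (j + p) (i + 1) hi').trans ?_
      rw [show j + p - ((i + 1 : ℕ) : ℤ) * p = j - i * p by push_cast; ring]
      exact GroupLeL.refl _
    · obtain rfl : q = i + 1 := by omega
      have h0 := hle (j + p) 0 hq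
      have h1 := h.mul_zpow hG ((j - i * p) / ((i + 1 : ℕ) : ℤ))
      refine GroupLeL.trans ?_ h1
      rw [← zpow_add]
      have : p + (j - i * p) / ((i + 1 : ℕ) : ℤ) = (j + p - (0 : ℕ) * p) / ((i + 1 : ℕ) : ℤ) := by
        rw [show j + p - (0 : ℕ) * p = (j - i * p) + p * ((i + 1 : ℕ) : ℤ) by push_cast; ring,
          Int.add_mul_ediv_right _ _ hq0, add_comm]
      rw [this]
      simpa using h0
  refine ⟨c, fun j k => ?_, hmono, fun n => ?_⟩
  · have key : ∀ w, GroupLeL P w (c (j + k * q)) ↔ GroupLeL P w (c j * (Δ : G) ^ k) := by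
      intro w
      rw [hc, ← mul_zpow_groupLeL_iff hG (-k) (y := c j * _), mul_assoc, ← zpow_add,
        add_neg_cancel, zpow_zero, mul_one, hc]
      refine forall₂_congr fun i _ => ?_
      rw [← mul_zpow_groupLeL_iff hG (-k), mul_assoc, ← zpow_add,
        show j + k * q - i * p = (j - i * p) + k * q by ring, Int.add_mul_ediv_right _ _ hq0,
        add_neg_cancel_right]
    exact GroupLeL.antisymm hG ((key _).1 (GroupLeL.refl _)) ((key _).2 (GroupLeL.refl _))
  · induction n with
    | zero => intro j; simpa using GroupLeL.refl _
    | succ n ih =>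
      intro j
      have h1 := hstep (j + n * p)
      have h2 := (ih j).mul_left g
      rw [show j + ((n + 1 : ℕ) : ℤ) * p = j + n * p + p by push_cast; ring, pow_succ', mul_assoc]
      exact h1.trans h2

/-- Rounding the index np down to a multiple of q lands on `c 0` times a power of Δ, so `c 0` is the
required conjugator. -/
theorem InfAtLeast.floor {g : G} {q : ℕ} (hq : 1 ≤ q) {p : ℤ} (h : InfAtLeast P Δ (g ^ q) p)
    (n : ℕ) : InfAtLeast P Δ (g ^ n) (n * p / q) := by
  obtain ⟨_, ⟨d, rfl⟩, hx⟩ := h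
  rw [← conj_pow_eq] at hx
  obtain ⟨c, h1, h2, h3⟩ := exists_ladder hG hq hx
  refine InfAtLeast.of_conj (h := (d⁻¹ * g * d) ^ n) ⟨d, conj_pow_eq d g n⟩ ?_
  refine infAtLeast_of_le (c := c 0) ?_
  rw [← h1]
  refine (h2 _ _ ?_).trans (h3 n 0)
  have := Int.ediv_mul_le (n * p) (show (q : ℤ) ≠ 0 by omega)
  linarith

/-- Pigeonhole on the ladder: a repeated rung gains one index step, which suffices to round np = mq
- 1 up to mq. -/
theorem InfAtLeast.exists_lt {g : G} {S : Finset G} (hS : ∀ x ∈ simples P Δ, x ∈ S) {q : ℕ}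
    (hq : 2 ≤ q) (hSq : S.card ≤ q) {p : ℤ} (hpq : Int.gcd p q = 1)
    (h : InfAtLeast P Δ (g ^ q) p) :
    ∃ n : ℕ, 1 ≤ n ∧ n < q ∧ ∃ m : ℤ, InfAtLeast P Δ (g ^ n) m ∧ n * p ≤ m * q := by
  obtain ⟨_, ⟨d, rfl⟩, hx⟩ := h
  rw [← conj_pow_eq] at hx
  obtain ⟨c, h1, h2, h3⟩ := exists_ladder hG (by omega) hx
  -- These quotients lie between 1 and Δ, because `c q` is `c 0 * Δ`.
  have hmaps : ∀ j ∈ Finset.range (q + 1), (c 0)⁻¹ * c j ∈ S := by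
    intro j hj
    rw [Finset.mem_range] at hj
    refine hS _ (mem_simples.2 ⟨groupLeL_iff.1 (h2 _ _ (by omega)), ?_⟩)
    have h4 := h1 0 1
    have h5 := groupLeL_iff.1 (h2 j (0 + 1 * q) (by omega))
    rw [h4] at h5
    simpa [mul_assoc] using h5
  obtain ⟨i, hi, j, hj, hij, heq⟩ := Finset.exists_ne_map_eq_of_card_lt_of_maps_to
    (by simpa using Nat.lt_succ_of_le hSq) hmaps
  rw [mul_right_inj] at heq
  -- Between two equal rungs of an increasing ladder all rungs agree, in particular the last two.
  obtain ⟨k, hk⟩ : ∃ k : ℤ, c (k - 1) = c k := by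
    rcases lt_or_gt_of_ne hij with hlt | hlt
    · refine ⟨j, GroupLeL.antisymm hG (h2 _ _ (by omega)) ?_⟩
      rw [← heq]
      exact h2 _ _ (by omega)
    · refine ⟨i, GroupLeL.antisymm hG (h2 _ _ (by omega)) ?_⟩
      rw [heq]
      exact h2 _ _ (by omega)
  have hb := Int.gcd_eq_gcd_ab p q
  rw [hpq] at hb
  set a := Int.gcdA p q
  set b := Int.gcdB p q
  -- By the Bézout identity 1 = pa + qb, the residue n of -a modulo q satisfies np ≡ -1; it is
  -- nonzero because q ≥ 2.
  obtain ⟨n, hn⟩ : ∃ n : ℕ, (n : ℤ) = (-a) % q :=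
    ⟨((-a) % q).toNat, Int.toNat_of_nonneg (Int.emod_nonneg _ (by omega))⟩
  have hn1 : (-a) % q < q := Int.emod_lt_of_pos _ (by omega)
  have hn2 := Int.emod_add_mul_ediv (-a) q
  rw [← hn] at hn1 hn2
  set t := (-a) / (q : ℤ)
  have hmq : (n : ℤ) * p = (b - t * p) * q - 1 := by
    have : (n : ℤ) = -a - q * t := by linarith
    rw [this]
    push_cast at hb
    linear_combination hb
  refine ⟨n, ?_, by omega, b - t * p, ?_, by omega⟩
  · rcases Nat.eq_zero_or_pos n with rfl | h0
    · have hd : (q : ℤ) ∣ 1 := ⟨b - t * p, by push_cast at hmq; linarith⟩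
      have := Int.le_of_dvd one_pos hd
      omega
    · exact h0
  · refine InfAtLeast.of_conj (h := (d⁻¹ * g * d) ^ n) ⟨d, conj_pow_eq d g n⟩ ?_
    refine infAtLeast_of_le (c := c k) ?_
    have h4 := h3 n k
    rw [show k + n * p = k - 1 + (b - t * p) * q by rw [hmq]; ring, h1, hk] at h4
    exact h4

/-- The slope of a lower bound for `inf_s` on powers is dominated by the slope of such a bound for
an exponent at most the number of simple elements. -/
theorem InfAtLeast.exists_small {g : G} {S : Finset G} (hS : ∀ x ∈ simples P Δ, x ∈ S) {q : ℕ}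
    (hq : 1 ≤ q) {p : ℤ} (h : InfAtLeast P Δ (g ^ q) p) :
    ∃ n : ℕ, 1 ≤ n ∧ n ≤ S.card ∧ ∃ m : ℤ, InfAtLeast P Δ (g ^ n) m ∧ n * p ≤ m * q := by
  have hS1 : 1 ≤ S.card := Finset.card_pos.2 ⟨1, hS 1 one_mem_simples⟩
  induction q using Nat.strong_induction_on generalizing p with
  | _ q ih =>
    rcases Nat.lt_or_ge S.card q with hlt | hge
    swap
    · exact ⟨q, hq, hge, p, h, by rw [mul_comm]⟩
    obtain ⟨n, hn1, hn2, m, hm, hnm⟩ : ∃ n : ℕ, 1 ≤ n ∧ n < q ∧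
        ∃ m : ℤ, InfAtLeast P Δ (g ^ n) m ∧ n * p ≤ m * q := by
      by_cases hd : Int.gcd p q = 1
      · exact InfAtLeast.exists_lt hG hS (by omega) hlt.le hd h
      -- Without coprimality, cancelling the common divisor keeps the slope and lowers the exponent;
      -- the floor bound is then exact.
      · obtain ⟨p', hp'⟩ : (Int.gcd p q : ℤ) ∣ p := Int.gcd_dvd_left ..
        obtain ⟨q', hq'⟩ : Int.gcd p q ∣ q := Int.natCast_dvd_natCast.1 (Int.gcd_dvd_right ..)
        generalize Int.gcd p q = d at *
        subst hp' hq'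
        have hd0 : d ≠ 0 := by rintro rfl; simp at hq
        have hq'0 : 1 ≤ q' := Nat.one_le_iff_ne_zero.2 (by rintro rfl; simp at hq)
        refine ⟨q', hq'0, ?_, p', ?_, ?_⟩
        · nlinarith [show 2 ≤ d by omega]
        · have := h.floor hG hq q'
          rwa [show (q' : ℤ) * (d * p') / ((d * q' : ℕ) : ℤ) = p' from ?_] at this
          rw [show (q' : ℤ) * (d * p') = p' * ((d * q' : ℕ) : ℤ) by push_cast; ring,
            Int.mul_ediv_cancel _ (by exact_mod_cast (by omega : d * q' ≠ 0))]
        · push_cast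
          exact le_of_eq (by ring)
    obtain ⟨n', h1, h2, m', h3, h4⟩ := ih n hn2 hn1 hm
    refine ⟨n', h1, h2, m', h3, ?_⟩
    have h5 : (n : ℤ) * (n' * p) ≤ n * (m' * q) := by nlinarith
    exact le_of_mul_le_mul_left h5 (by omega)

theorem pow_groupLeL {h : G} {a : ℤ} (ha : GroupLeL P ((Δ : G) ^ a) h) (n : ℕ) :
    GroupLeL P ((Δ : G) ^ (n * a)) (h ^ n) := by
  induction n with
  | zero => simpa using GroupLeL.refl _
  | succ n ih =>
    have := groupLeL_mul hG ih ha
    rwa [← pow_succ, show n * a + a = ((n + 1 : ℕ) : ℤ) * a by push_cast; ring] at this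

/-- If the powers `h ^ n` attain `inf_s (g ^ n)` for all `n` up to the number of simple elements,
then they do so for all `n`. -/
theorem groupLeL_pow_of_infAtLeast {g h : G} {S : Finset G} (hS : ∀ x ∈ simples P Δ, x ∈ S)
    (H : ∀ n : ℕ, 1 ≤ n → n ≤ S.card → ∀ r, InfAtLeast P Δ (g ^ n) r →
      GroupLeL P ((Δ : G) ^ r) (h ^ n))
    {n : ℕ} (hn : 1 ≤ n) {r : ℤ} (hr : InfAtLeast P Δ (g ^ n) r) :
    GroupLeL P ((Δ : G) ^ r) (h ^ n) := by
  -- Here p/q ≥ r/n with q small. Writing n = q(n/q) + (n mod q), the two factors of h^n contribute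
  -- p(n/q) and ⌊(n mod q)p/q⌋, whose sum is ⌊np/q⌋ ≥ r.
  obtain ⟨q, hq1, hqS, p, hp, hle⟩ := hr.exists_small hG hS hn
  have h1 := pow_groupLeL hG (H q hq1 hqS p hp) (n / q)
  have h2 : GroupLeL P ((Δ : G) ^ (((n % q : ℕ) : ℤ) * p / q)) (h ^ (n % q)) := by
    rcases Nat.eq_zero_or_pos (n % q) with h0 | h0
    · simpa [h0] using GroupLeL.refl _
    · exact H _ h0 ((Nat.mod_lt _ (by omega)).le.trans hqS) _ (hp.floor hG hq1 _)
  have h3 := groupLeL_mul hG h1 h2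
  rw [← pow_mul, ← pow_add, Nat.div_add_mod] at h3
  refine (delta_zpow_groupLeL ?_).trans h3
  have hq0 : (0 : ℤ) < q := by omega
  rw [add_comm, ← Int.add_mul_ediv_left _ _ hq0.ne', Int.le_ediv_iff_mul_le hq0]
  have hdm : ((n % q : ℕ) : ℤ) + q * ((n / q : ℕ) : ℤ) = n := by exact_mod_cast Nat.mod_add_div n q
  calc r * q = q * r := mul_comm _ _
    _ ≤ p * n := hle
    _ = _ := by rw [← hdm]; ring

end Powers

/-! ### Super summit sets through lower bounds, without suprema -/

section SuperSummit

variable {G : Type*} [Group G] {P : Submonoid G} {Δ : P}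
variable (hG : IsGarsideGroup P Δ)
include hG

/-- If Δ = 1, all simple elements are units, hence trivial, and they generate. This isolates the one
case in which inf and sup take default values. -/
theorem subsingleton_of_delta_eq_one (h : (Δ : G) = 1) : Subsingleton G := by
  have h1 : ∀ a ∈ P, a = 1 := by
    intro a ha
    rw [← closure_simples hG] at ha
    induction ha using Submonoid.closure_induction with
    | mem x hx =>
      rw [mem_simples, h, mul_one] at hx
      exact eq_one_of_inv_mem hG hx.1 hx.2
    | one => rfl
    | mul x y _ _ hx hy => rw [hx, hy, mul_one]
  refine subsingleton_of_forall_eq 1 fun g => ?_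
  obtain ⟨a, ha, b, hb, rfl⟩ := hG.fractions g
  simp [h1 a ha, h1 b hb]

theorem le_of_delta_zpow_groupLeL (h : (Δ : G) ≠ 1) {r s : ℤ}
    (hrs : GroupLeL P ((Δ : G) ^ r) ((Δ : G) ^ s)) : r ≤ s := by
  by_contra! hlt
  refine h (eq_one_of_inv_mem hG Δ.2 ?_)
  have h1 : GroupLeL P ((Δ : G) ^ (s + 1)) ((Δ : G) ^ s) :=
    (delta_zpow_groupLeL (by omega)).trans hrs
  rw [groupLeL_iff] at h1
  simpa [zpow_add_one, mul_assoc] using h1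

/-- For Δ ≠ 1 the powers of Δ are strictly increasing, so the supremum defining inf is over a
nonempty bounded set of integers and is attained. -/
theorem groupLeL_iff_le_inf (h : (Δ : G) ≠ 1) {r : ℤ} {x : G} :
    GroupLeL P ((Δ : G) ^ r) x ↔ r ≤ inf P Δ x := by
  obtain ⟨m, hm⟩ := exists_zpow_le hG x
  obtain ⟨k, hk⟩ := exists_le_zpow hG x
  have hb : BddAbove {r : ℤ | GroupLeL P ((Δ : G) ^ r) x} :=
    ⟨k, fun r hr => le_of_delta_zpow_groupLeL hG h (hr.trans (by simpa using hk))⟩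
  have hmem := Int.csSup_mem ⟨-(m : ℤ), hm⟩ hb
  exact ⟨fun hr => le_csSup hb hr, fun hr => (delta_zpow_groupLeL hr).trans hmem⟩

theorem groupLeL_iff_sup_le (h : (Δ : G) ≠ 1) {r : ℤ} {x : G} :
    GroupLeL P x ((Δ : G) ^ r) ↔ sup P Δ x ≤ r := by
  obtain ⟨m, hm⟩ := exists_zpow_le hG x
  obtain ⟨k, hk⟩ := exists_le_zpow hG x
  have hb : BddBelow {r : ℤ | GroupLeL P x ((Δ : G) ^ r)} :=
    ⟨-m, fun r hr => le_of_delta_zpow_groupLeL hG h (hm.trans hr)⟩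
  have hmem := Int.csInf_mem ⟨(k : ℤ), by simpa using hk⟩ hb
  exact ⟨fun hr => csInf_le hb hr, fun hr => hmem.trans (delta_zpow_groupLeL hr)⟩

theorem isGreatest_inf_iff {g h : G} (hh : h ∈ conjClass g) :
    IsGreatest (inf P Δ '' conjClass g) (inf P Δ h) ↔
      ∀ r, InfAtLeast P Δ g r → GroupLeL P ((Δ : G) ^ r) h := by
  by_cases hΔ : (Δ : G) = 1
  · have := subsingleton_of_delta_eq_one hG hΔ
    refine iff_of_true ⟨⟨h, hh, rfl⟩, ?_⟩ fun r _ => ?_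
    · rintro _ ⟨x, _, rfl⟩
      rw [Subsingleton.elim x h]
    · rw [Subsingleton.elim (_ ^ r) h]
      exact GroupLeL.refl h
  · constructor
    · rintro ⟨-, H⟩ r ⟨x, hx, hr⟩
      rw [groupLeL_iff_le_inf hG hΔ] at hr ⊢
      exact hr.trans (H ⟨x, hx, rfl⟩)
    · refine fun H => ⟨⟨h, hh, rfl⟩, ?_⟩
      rintro _ ⟨x, hx, rfl⟩
      rw [← groupLeL_iff_le_inf hG hΔ]
      exact H _ ⟨x, hx, (groupLeL_iff_le_inf hG hΔ).2 le_rfl⟩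

theorem isLeast_sup_iff {g h : G} (hh : h ∈ conjClass g) :
    IsLeast (sup P Δ '' conjClass g) (sup P Δ h) ↔
      ∀ r, InfAtLeast P Δ g⁻¹ r → GroupLeL P ((Δ : G) ^ r) h⁻¹ := by
  by_cases hΔ : (Δ : G) = 1
  · have := subsingleton_of_delta_eq_one hG hΔ
    refine iff_of_true ⟨⟨h, hh, rfl⟩, ?_⟩ fun r _ => ?_
    · rintro _ ⟨x, _, rfl⟩
      rw [Subsingleton.elim x h]
    · rw [Subsingleton.elim (_ ^ r) h⁻¹]
      exact GroupLeL.refl _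
  · have key : ∀ {x : G} {r : ℤ}, GroupLeL P ((Δ : G) ^ r) x⁻¹ ↔ sup P Δ x ≤ -r := fun {x r} => by
      rw [← groupLeL_iff_sup_le hG hΔ, ← groupLeL_inv_iff hG, neg_neg]
    constructor
    · rintro ⟨-, H⟩ r ⟨x, hx, hr⟩
      rw [← inv_inv x, key] at hr
      rw [key]
      exact (H ⟨x⁻¹, by simpa using inv_mem_conjClass hx, rfl⟩).trans hr
    · refine fun H => ⟨⟨h, hh, rfl⟩, ?_⟩
      rintro _ ⟨x, hx, rfl⟩
      have := H (-sup P Δ x) ⟨x⁻¹, inv_mem_conjClass hx, key.2 (by simp)⟩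
      rw [key] at this
      omega

theorem mem_superSummitSet_iff {g h : G} : h ∈ superSummitSet P Δ g ↔ h ∈ conjClass g ∧
    (∀ r, InfAtLeast P Δ g r → GroupLeL P ((Δ : G) ^ r) h) ∧
      ∀ r, InfAtLeast P Δ g⁻¹ r → GroupLeL P ((Δ : G) ^ r) h⁻¹ := by
  refine and_congr_right fun hh => ?_
  rw [isGreatest_inf_iff hG hh, isLeast_sup_iff hG hh]

/-- Membership in the stable super summit set only has to be tested on the powers with exponent at
most the number of simple elements. -/
theorem mem_stableSuperSummitSet_iff {g h : G} {S : Finset G} (hS : ∀ x ∈ simples P Δ, x ∈ S)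
    {N : ℕ} (hN : S.card ≤ N) :
    h ∈ stableSuperSummitSet P Δ g ↔ h ∈ conjClass g ∧ ∀ n : ℕ, 1 ≤ n → n ≤ N →
      (∀ r, InfAtLeast P Δ (g ^ n) r → GroupLeL P ((Δ : G) ^ r) (h ^ n)) ∧
        ∀ r, InfAtLeast P Δ (g⁻¹ ^ n) r → GroupLeL P ((Δ : G) ^ r) (h⁻¹ ^ n) := by
  simp only [inv_pow]
  constructor
  · rintro ⟨h1, h2⟩
    exact ⟨h1.1, fun n hn _ => ((mem_superSummitSet_iff hG).1 (h2 n hn)).2⟩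
  · rintro ⟨h1, h2⟩
    have key : ∀ n : ℕ, 1 ≤ n → h ^ n ∈ superSummitSet P Δ (g ^ n) := by
      intro n hn
      refine (mem_superSummitSet_iff hG).2 ⟨pow_mem_conjClass h1 n, fun r hr => ?_, fun r hr => ?_⟩
      · exact groupLeL_pow_of_infAtLeast hG hS
          (fun n h3 h4 => (h2 n h3 (h4.trans hN)).1) hn hr
      · rw [← inv_pow] at hr ⊢
        refine groupLeL_pow_of_infAtLeast hG hS (fun n h3 h4 => ?_) hn hr
        rw [inv_pow, inv_pow]
        exact (h2 n h3 (h4.trans hN)).2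
    exact ⟨by simpa using key 1 le_rfl, key⟩

/-- If `inf_s g ≥ r` and `g ≤_L Δ ^ b`, then some conjugate of `g` lies between `Δ ^ r` and
`Δ ^ b`. -/
theorem InfAtLeast.exists_le {g : G} {r b : ℤ} (h : InfAtLeast P Δ g r)
    (hb : GroupLeL P g ((Δ : G) ^ b)) :
    ∃ x ∈ conjClass g, GroupLeL P ((Δ : G) ^ r) x ∧ GroupLeL P x ((Δ : G) ^ b) := by
  obtain ⟨ν, hν1, hν2⟩ := hG.garsideMonoid.atomic.exists_norm
  -- The positive `c` with c Δ^r ≤ g c are closed under meets, so one of minimal length is the least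
  -- of them.
  let Q : ℕ → Prop := fun k => ∃ c : P, GroupLeL P (c * (Δ : G) ^ r) (g * c) ∧ ν c = k
  have hQ : ∃ k, Q k := by
    obtain ⟨_, ⟨d, rfl⟩, hd⟩ := h
    obtain ⟨m, hm⟩ := exists_zpow_le hG d
    have hdP : d * (Δ : G) ^ (m : ℤ) ∈ P := by
      have := conj_zpow_mem hG (groupLeL_iff.1 hm) m
      simpa using this
    refine ⟨_, ⟨_, hdP⟩, ?_, rfl⟩
    simp only
    rw [mul_assoc, ← zpow_add, add_comm, zpow_add, ← mul_assoc, ← mul_assoc, mul_zpow_groupLeL_iff hG]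
    simpa [mul_assoc] using hd.mul_left d
  classical
  obtain ⟨c, hc, hck⟩ := Nat.find_spec hQ
  have hmin : ∀ c' : P, GroupLeL P (c' * (Δ : G) ^ r) (g * c') → ν c ≤ ν c' := fun c' h' =>
    hck.le.trans (Nat.find_min' hQ ⟨c', h', rfl⟩)
  have hleast : ∀ c' ∈ P, GroupLeL P (c' * (Δ : G) ^ r) (g * c') → GroupLeL P c c' := by
    intro c' hc' h'
    obtain ⟨m, hm⟩ := exists_meet hG (c : G) c'
    obtain ⟨hmc, hmc'⟩ := (hm m).1 (GroupLeL.refl m)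
    have hmP : m ∈ P := one_groupLeL_iff.1 <|
      (hm 1).2 ⟨one_groupLeL_iff.2 c.2, one_groupLeL_iff.2 hc'⟩
    have hm2 : GroupLeL P (m * (Δ : G) ^ r) (g * m) := by
      rw [← inv_inv g, ← mul_groupLeL_iff, hm, mul_groupLeL_iff (g := g⁻¹),
        mul_groupLeL_iff (g := g⁻¹), inv_inv]
      exact ⟨(hmc.mul_zpow hG r).trans hc, (hmc'.mul_zpow hG r).trans h'⟩
    obtain ⟨u, hu, huc⟩ := hmc
    have h1 := hmin ⟨m, hmP⟩ hm2
    have h2 := hν1 ⟨m, hmP⟩ ⟨u, hu⟩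
    have h3 : (⟨m, hmP⟩ : P) * ⟨u, hu⟩ = c := Subtype.ext huc
    rw [h3] at h2
    have h4 : u = 1 := by
      by_contra hne
      have := hν2 ⟨u, hu⟩ (by simpa [Subtype.ext_iff] using hne)
      omega
    rw [h4, mul_one] at huc
    rwa [← huc]
  refine ⟨(c : G)⁻¹ * g * c, ⟨c, rfl⟩, by simpa [mul_groupLeL_iff, mul_assoc] using hc, ?_⟩
  -- The element g⁻¹ c Δ^b belongs to the same set, being positive since g ≤ Δ^b. Leastness of `c`
  -- puts `c` below it, which is the upper bound c⁻¹ g c ≤ Δ^b.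
  have h1 : GroupLeL P (c : G) (g⁻¹ * (c * (Δ : G) ^ b)) := by
    refine hleast _ ?_ ?_
    · have h2 := P.mul_mem (groupLeL_iff.1 hb) (conj_zpow_mem hG c.2 b)
      simpa [mul_assoc] using h2
    · rw [mul_assoc, mul_groupLeL_iff, inv_inv, mul_assoc, ← zpow_add, add_comm, zpow_add,
        ← mul_assoc, mul_inv_cancel_left, ← mul_assoc]
      exact hc.mul_zpow hG b
  rw [← mul_groupLeL_iff] at h1
  rw [mul_assoc, mul_groupLeL_iff, inv_inv]
  exact h1

end SuperSummit

/-! ### Conjugacy inside the set of bounded elements -/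

section BoundedClass

variable {G : Type*} [Group G] {P : Submonoid G} {Δ : P}

variable (P Δ) in
/-- `x` lies between `Δ ^ (-R)` and `Δ ^ R`. -/
def IsBounded (R : ℕ) (x : G) : Prop :=
  GroupLeL P ((Δ : G) ^ (-(R : ℤ))) x ∧ GroupLeL P x ((Δ : G) ^ (R : ℤ))

variable (P Δ) in
/-- The elements between `Δ ^ (-R)` and `Δ ^ R`, joined when a simple element conjugates one to the
other. -/
def conjGraph (R : ℕ) : SimpleGraph {x : G // IsBounded P Δ R x} :=
  SimpleGraph.fromRel fun x y => ∃ s ∈ simples P Δ, (y : G) = s⁻¹ * x * s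

theorem conjGraph_reachable {R : ℕ} {x y : {x : G // IsBounded P Δ R x}}
    (h : ∃ s ∈ simples P Δ, (y : G) = s⁻¹ * x * s) : (conjGraph P Δ R).Reachable x y := by
  by_cases hxy : x = y
  · rw [hxy]
  · exact SimpleGraph.Adj.reachable <| (SimpleGraph.fromRel_adj ..).2 ⟨hxy, Or.inl h⟩

theorem IsBounded.mono {R R' : ℕ} (h : R ≤ R') {x : G} (hx : IsBounded P Δ R x) :
    IsBounded P Δ R' x :=
  ⟨(delta_zpow_groupLeL (by omega)).trans hx.1, hx.2.trans (delta_zpow_groupLeL (by omega))⟩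

theorem isBounded_of_mem_simples {x : G} (hx : x ∈ simples P Δ) : IsBounded P Δ 1 x := by
  rw [mem_simples] at hx
  constructor
  · refine (delta_zpow_groupLeL (j := 0) (by simp)).trans ?_
    simpa using one_groupLeL_iff.2 hx.1
  · rw [groupLeL_iff]
    simpa using hx.2

variable (hG : IsGarsideGroup P Δ)
include hG

theorem IsBounded.mul {R R' : ℕ} {x y : G} (hx : IsBounded P Δ R x) (hy : IsBounded P Δ R' y) :
    IsBounded P Δ (R + R') (x * y) := by
  constructor
  · rw [show (-((R + R' : ℕ) : ℤ)) = -(R : ℤ) + -(R' : ℤ) by push_cast; ring]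
    exact groupLeL_mul hG hx.1 hy.1
  · push_cast
    exact mul_groupLeL hG hx.2 hy.2

theorem IsBounded.inv {R : ℕ} {x : G} (hx : IsBounded P Δ R x) : IsBounded P Δ R x⁻¹ :=
  ⟨(groupLeL_inv_iff hG).2 hx.2, by
    rw [← groupLeL_inv_iff hG, inv_inv]
    exact hx.1⟩

theorem IsBounded.conj_delta {R : ℕ} {x : G} (hx : IsBounded P Δ R x) (k : ℤ) :
    IsBounded P Δ R ((Δ : G) ^ (-k) * x * (Δ : G) ^ k) := by
  constructor
  · rw [mul_assoc, zpow_neg _ k, ← mul_groupLeL_iff, ← zpow_add, add_comm, zpow_add]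
    exact hx.1.mul_zpow hG k
  · rw [mul_assoc, mul_groupLeL_iff, zpow_neg _ k, inv_inv, ← zpow_add, add_comm, zpow_add]
    exact hx.2.mul_zpow hG k

/-- Convexity: if conjugation by `c` keeps `x` bounded, then so does conjugation by the simple
element c ∧ Δ. Splitting it off shortens `c`. -/
theorem conjGraph_reachable_of_mem {R : ℕ} {c : G} (hc : c ∈ P)
    {x y : {x : G // IsBounded P Δ R x}} (h : (y : G) = c⁻¹ * x * c) :
    (conjGraph P Δ R).Reachable x y := by
  obtain ⟨ν, hν1, hν2⟩ := hG.garsideMonoid.atomic.exists_norm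
  obtain ⟨k, hk⟩ : ∃ k, ν ⟨c, hc⟩ = k := ⟨_, rfl⟩
  induction k using Nat.strong_induction_on generalizing c x with
  | _ k ih =>
    by_cases hc1 : c = 1
    · obtain rfl : x = y := Subtype.ext (by simp [h, hc1])
      exact SimpleGraph.Reachable.refl _
    obtain ⟨m, hm⟩ := exists_meet hG c (Δ : G)
    obtain ⟨hmc, hmΔ⟩ := (hm m).1 (GroupLeL.refl m)
    have hmP : m ∈ P := one_groupLeL_iff.1 <|
      (hm 1).2 ⟨one_groupLeL_iff.2 hc, one_groupLeL_iff.2 Δ.2⟩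
    have hms : m ∈ simples P Δ := mem_simples.2 ⟨hmP, groupLeL_iff.1 hmΔ⟩
    have hm1 : m ≠ 1 := by
      -- If c ∧ Δ = 1, the first letter of a simple factorization of `c` divides both and is
      -- trivial, and so on through all letters.
      rintro rfl
      obtain ⟨l, hl, hlc⟩ := exists_simple_list hG hc
      have hl1 : ∀ z ∈ l, z = 1 := by
        clear hk ih hν1 hν2
        induction l generalizing c with
        | nil => simp
        | cons a l ihl =>
          have ha := hl a (by simp)
          have hlP : l.prod ∈ P := P.list_prod_mem fun z hz => (mem_simples.1 (hl z (by simp [hz]))).1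
          have ha1 : a = 1 := by
            refine eq_one_of_inv_mem hG (mem_simples.1 ha).1 ?_
            have := (hm a).2 ⟨⟨l.prod, hlP, by simpa using hlc⟩, groupLeL_iff.2 (mem_simples.1 ha).2⟩
            simpa [groupLeL_iff] using this
          have hlc' : l.prod = c := by simpa [ha1] using hlc
          intro z hz
          rcases List.mem_cons.1 hz with rfl | hz
          · exact ha1
          · exact ihl hc h hc1 hm hmc (fun z hz => hl z (by simp [hz])) hlc' z hz
      exact hc1 (by rw [← hlc]; exact List.prod_eq_one hl1)
    -- Each bound on the conjugate by the meet follows from the same bound on the conjugates by `c`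
    -- and by Δ.
    have hxm : IsBounded P Δ R (m⁻¹ * x * m) := by
      have hy := y.2
      rw [h] at hy
      constructor
      · rw [mul_assoc, ← mul_groupLeL_iff, ← inv_inv (x : G), ← mul_groupLeL_iff, hm,
          mul_groupLeL_iff (g := (x : G)⁻¹), mul_groupLeL_iff (g := (x : G)⁻¹), inv_inv]
        constructor
        · refine (hmc.mul_zpow hG _).trans ?_
          rw [mul_groupLeL_iff, ← mul_assoc]
          exact hy.1
        · refine (hmΔ.mul_zpow hG _).trans ?_
          have := x.2.1.mul_zpow hG 1
          rw [← zpow_add, add_comm, zpow_add, zpow_one] at this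
          exact this
      · rw [mul_assoc, mul_groupLeL_iff, inv_inv, ← mul_zpow_groupLeL_iff hG (-(R : ℤ)),
          mul_assoc m, ← zpow_add, add_neg_cancel, zpow_zero, mul_one, hm]
        constructor
        · rw [← mul_zpow_groupLeL_iff hG (R : ℤ), mul_assoc, ← zpow_add, neg_add_cancel, zpow_zero,
            mul_one]
          refine (hmc.mul_left _).trans ?_
          have := hy.2
          rwa [mul_assoc, mul_groupLeL_iff, inv_inv] at this
        · rw [← mul_zpow_groupLeL_iff hG (R : ℤ), mul_assoc, ← zpow_add, neg_add_cancel, zpow_zero,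
            mul_one]
          refine (hmΔ.mul_left _).trans ?_
          have := x.2.2.mul_zpow hG 1
          rw [← zpow_add, add_comm, zpow_add, zpow_one] at this
          exact this
    obtain ⟨u, hu, huc⟩ := hmc
    have hmu : (⟨m, hmP⟩ : P) * ⟨u, hu⟩ = ⟨c, hc⟩ := Subtype.ext huc
    have h1 := hν1 ⟨m, hmP⟩ ⟨u, hu⟩
    have h2 := hν2 ⟨m, hmP⟩ (by simpa [Subtype.ext_iff] using hm1)
    rw [hmu] at h1
    refine SimpleGraph.Reachable.trans (conjGraph_reachable (y := ⟨_, hxm⟩) ⟨m, hms, rfl⟩) ?_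
    refine ih _ ?_ hu ?_ rfl
    · omega
    · rw [h, ← huc]
      group

/-- An arbitrary conjugator is a positive element times Δ^(-m). The intermediate vertex is bounded
because conjugation by Δ preserves the bounds. -/
theorem conjGraph_reachable_of_mem_conjClass {R : ℕ} {x y : {x : G // IsBounded P Δ R x}}
    (h : (y : G) ∈ conjClass (x : G)) : (conjGraph P Δ R).Reachable x y := by
  obtain ⟨d, hd⟩ := h
  obtain ⟨m, hm⟩ := exists_zpow_le hG d
  have hdP : d * (Δ : G) ^ (m : ℤ) ∈ P := by
    have := conj_zpow_mem hG (groupLeL_iff.1 hm) m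
    simpa using this
  let z : {x : G // IsBounded P Δ R x} := ⟨_, y.2.conj_delta hG m⟩
  have hxz : (conjGraph P Δ R).Reachable x z := by
    refine conjGraph_reachable_of_mem hG hdP ?_
    simp only [z, hd]
    group
  have hyz : (conjGraph P Δ R).Reachable y z := by
    refine conjGraph_reachable_of_mem hG (c := (Δ : G) ^ (m : ℤ)) ?_ ?_
    · rw [zpow_natCast]
      exact P.pow_mem Δ.2 m
    · simp only [z]
      group
  exact hxz.trans hyz.symm

/-- Two conjugate bounded elements are conjugate by a product of boundedly many simple elements and
inverses of simple elements. -/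
theorem exists_short_conj {R B : ℕ} {F : Finset G} (hF : ∀ x, IsBounded P Δ R x → x ∈ F)
    (hFB : F.card ≤ B) {x y : G} (hx : IsBounded P Δ R x) (hy : IsBounded P Δ R y)
    (h : y ∈ conjClass x) :
    ∃ l : List G, l.length = B ∧ (∀ u ∈ l, u ∈ simples P Δ ∨ u⁻¹ ∈ simples P Δ) ∧
      y = l.prod⁻¹ * x * l.prod := by
  classical
  have hfin : {x : G | IsBounded P Δ R x}.Finite := F.finite_toSet.subset hF
  have : Fintype {x : G // IsBounded P Δ R x} := hfin.fintype
  have hcard : Fintype.card {x : G // IsBounded P Δ R x} ≤ B := by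
    refine le_trans ?_ hFB
    rw [← Fintype.card_coe]
    exact Fintype.card_le_of_injective (fun x => (⟨x.1, hF _ x.2⟩ : F)) fun a b hab =>
      Subtype.ext (congrArg (fun z : F => (z : G)) hab)
  obtain ⟨p, hp⟩ := (conjGraph_reachable_of_mem_conjClass hG
    (x := ⟨x, hx⟩) (y := ⟨y, hy⟩) h).exists_isPath
  have hlen := hp.length_lt
  have key : ∀ {a b : {x : G // IsBounded P Δ R x}} (p : (conjGraph P Δ R).Walk a b),
      ∃ l : List G, l.length = p.length ∧ (∀ u ∈ l, u ∈ simples P Δ ∨ u⁻¹ ∈ simples P Δ) ∧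
        (b : G) = l.prod⁻¹ * a * l.prod := by
    intro a b p
    induction p with
    | nil => exact ⟨[], rfl, by simp, by simp⟩
    | @cons a c b hac p ih =>
      obtain ⟨l, h1, h2, h3⟩ := ih
      obtain ⟨-, ⟨s, hs, h4⟩ | ⟨s, hs, h4⟩⟩ := (SimpleGraph.fromRel_adj ..).1 hac
      · refine ⟨s :: l, by simp [h1], ?_, ?_⟩
        · intro u hu
          rcases List.mem_cons.1 hu with rfl | hu
          exacts [Or.inl hs, h2 u hu]
        · rw [h3, h4, List.prod_cons]
          group
      · refine ⟨s⁻¹ :: l, by simp [h1], ?_, ?_⟩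
        · intro u hu
          rcases List.mem_cons.1 hu with rfl | hu
          exacts [Or.inr (by simpa using hs), h2 u hu]
        · rw [h3, h4, List.prod_cons]
          group
  obtain ⟨l, h1, h2, h3⟩ := key p
  -- Padding with the simple element 1 gives length exactly `B`, matching a list of words of one
  -- fixed length.
  refine ⟨l ++ List.replicate (B - l.length) 1, ?_, ?_, ?_⟩
  · simp
    omega
  · intro u hu
    rcases List.mem_append.1 hu with hu | hu
    · exact h2 u hu
    · rw [List.eq_of_mem_replicate hu]
      exact Or.inl one_mem_simples
  · simpa using h3

/-- If the simple element `x` left divides `s * p`, where `s` is simple and `p` is positive, then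
this is due to a common multiple of `x` and `s` that is simple. -/
theorem exists_simple_complement {x s p : G} (hx : x ∈ simples P Δ) (hs : s ∈ simples P Δ)
    (hp : p ∈ P) (h : x⁻¹ * (s * p) ∈ P) :
    ∃ u ∈ simples P Δ, ∃ t ∈ simples P Δ, s * t ∈ simples P Δ ∧ x * u = s * t ∧ t⁻¹ * p ∈ P := by
  rw [mem_simples] at hx hs
  obtain ⟨-, m, ⟨u, hu⟩, ⟨t, ht⟩, hm⟩ := hG.garsideMonoid.latticeL ⟨x, hx.1⟩ ⟨s, hs.1⟩
  obtain ⟨a, ha⟩ := hm Δ ⟨⟨_, hx.2⟩, Subtype.ext (by simp)⟩ ⟨⟨_, hs.2⟩, Subtype.ext (by simp)⟩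
  obtain ⟨b, hb⟩ := hm ⟨s * p, P.mul_mem hs.1 hp⟩ ⟨⟨_, h⟩, Subtype.ext (by simp)⟩
    ⟨⟨p, hp⟩, Subtype.ext (by simp)⟩
  have hu' : x * u = m := congrArg Subtype.val hu
  have ht' : s * t = m := congrArg Subtype.val ht
  have ha' : (m : G) * a = Δ := congrArg Subtype.val ha
  have hb' : (m : G) * b = s * p := congrArg Subtype.val hb
  have hms : (m : G) ∈ simples P Δ := mem_simples.2 ⟨m.2, by rw [← ha']; simp⟩
  have hmR := ((mem_simples' hG).1 hms).2
  refine ⟨u, (mem_simples' hG).2 ⟨u.2, ?_⟩, t, (mem_simples' hG).2 ⟨t.2, ?_⟩, ?_, ?_, ?_⟩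
  · rw [← hu'] at hmR
    simpa [mul_assoc] using P.mul_mem hmR hx.1
  · rw [← ht'] at hmR
    simpa [mul_assoc] using P.mul_mem hmR hs.1
  · rwa [ht']
  · rw [hu', ht']
  · rw [← ht', mul_assoc, mul_right_inj] at hb'
    simp [← hb']

/-- The complement passes along the list, one letter replaced by one letter, so division does not
increase the number of simple factors. -/
theorem exists_list_simple_div {x : G} (hx : x ∈ simples P Δ) {l : List G}
    (hl : ∀ u ∈ l, u ∈ simples P Δ) (h : x⁻¹ * l.prod ∈ P) :
    ∃ l' : List G, l'.length = l.length ∧ (∀ u ∈ l', u ∈ simples P Δ) ∧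
      l'.prod = x⁻¹ * l.prod := by
  induction l generalizing x with
  | nil =>
    have : x = 1 := eq_one_of_inv_mem hG (mem_simples.1 hx).1 (by simpa using h)
    exact ⟨[], rfl, by simp, by simp [this]⟩
  | cons s l ih =>
    have hlP : l.prod ∈ P := P.list_prod_mem fun z hz => (mem_simples.1 (hl z (by simp [hz]))).1
    obtain ⟨u, hu, t, ht, -, h1, h2⟩ := exists_simple_complement hG hx (hl s (by simp)) hlP
      (by simpa using h)
    obtain ⟨l', h3, h4, h5⟩ := ih ht (fun z hz => hl z (by simp [hz])) h2
    refine ⟨u :: l', by simp [h3], ?_, ?_⟩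
    · intro z hz
      rcases List.mem_cons.1 hz with rfl | hz
      exacts [hu, h4 z hz]
    · rw [List.prod_cons, List.prod_cons, h5, show u = x⁻¹ * (s * t) by rw [← h1]; simp]
      group

theorem exists_list_div {l p : List G} (hl : ∀ u ∈ l, u ∈ simples P Δ)
    (hp : ∀ u ∈ p, u ∈ simples P Δ) (h : l.prod⁻¹ * p.prod ∈ P) :
    ∃ l' : List G, l'.length = p.length ∧ (∀ u ∈ l', u ∈ simples P Δ) ∧
      l'.prod = l.prod⁻¹ * p.prod := by
  induction l generalizing p with
  | nil => exact ⟨p, rfl, hp, by simp⟩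
  | cons a l ih =>
    have hlP : l.prod ∈ P := P.list_prod_mem fun z hz => (mem_simples.1 (hl z (by simp [hz]))).1
    obtain ⟨p', h1, h2, h3⟩ := exists_list_simple_div hG (hl a (by simp)) hp
      (by simpa [mul_assoc] using P.mul_mem hlP h)
    obtain ⟨l', h4, h5, h6⟩ := ih (p := p') (fun z hz => hl z (by simp [hz])) h2
      (by simpa [h3, mul_assoc] using h)
    exact ⟨l', h4.trans h1, h5, by simp [h6, h3, mul_assoc]⟩

/-- The element x⁻¹ Δ^R is the quotient of Δ^(2R) by the positive element Δ^R x, so 2R simple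
factors suffice. This bounds the number of bounded elements by a number of words. -/
theorem IsBounded.exists_list {R : ℕ} {x : G} (hx : IsBounded P Δ R x) :
    ∃ l : List G, l.length = 2 * R ∧ (∀ u ∈ l, u ∈ simples P Δ) ∧
      l.prod = x⁻¹ * (Δ : G) ^ (R : ℤ) := by
  obtain ⟨l, h1, h2⟩ := exists_simple_list hG (groupLeL_iff.1 hx.1)
  have hΔ : l.prod⁻¹ * (List.replicate (2 * R) (Δ : G)).prod = x⁻¹ * (Δ : G) ^ (R : ℤ) := by
    rw [h2, List.prod_replicate, ← zpow_natCast, two_mul, Nat.cast_add, zpow_add]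
    simp [mul_assoc]
  obtain ⟨l', h3, h4, h5⟩ := exists_list_div hG (p := List.replicate (2 * R) (Δ : G)) h1
    (fun u hu => by rw [List.eq_of_mem_replicate hu]; exact delta_mem_simples)
    (by rw [hΔ]; exact groupLeL_iff.1 hx.2)
  exact ⟨l', by simpa using h3, h4, by rw [h5, hΔ]⟩

end BoundedClass

/-! ### The algorithm -/

/-- The position of the Garside element: every simple element divides it. -/
def deltaIndex (T : List (ℕ × ℕ × ℕ)) : ℕ :=
  ((T.map Prod.fst).filter fun i => ∀ α ∈ T, ∃ β ∈ T, β.1 = α.1 ∧ β.2.2 = i).headI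

/-- If `i * t = m` and `x * u = m` by the entries `α` and `β` of the table, and if `p = t * q`, then
`i * p = x * (u * q)`. -/
def quotientStep (i : ℕ) (r : ℕ × List ℕ) (α β : ℕ × ℕ × ℕ) : List (ℕ × List ℕ) :=
  if α.1 = i ∧ α.2.1 = r.1 ∧ β.2.2 = α.2.2 then [(β.1, β.2.1 :: r.2)] else []

/-- All pairs `(x, p')` for which the table shows, letter by letter, that `x * p' = p`. -/
def quotients (T : List (ℕ × ℕ × ℕ)) (p : List ℕ) : List (ℕ × List ℕ) :=
  p.foldr (fun i acc => acc.flatMap fun r => T.flatMap fun α => T.flatMap fun β =>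
      quotientStep i r α β)
    ((T.filter fun α => α.2.1 = α.1 ∧ α.2.2 = α.1).map fun α => (α.1, []))

/-- Left multiplication of positive words by a letter; quotients that do not exist are dropped. -/
def actLetter (T : List (ℕ × ℕ × ℕ)) (a : ℕ × Bool) (C : List (List ℕ)) : List (List ℕ) :=
  if a.2 = true then C.map fun p => a.1 :: p
  else C.flatMap fun p => ((quotients T p).filter fun r => r.1 = a.1).map Prod.snd

/-- Left multiplication of positive words by a word. -/
def act (T : List (ℕ × ℕ × ℕ)) (w : Word) (C : List (List ℕ)) : List (List ℕ) :=
  w.foldr (actLetter T) C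

/-- The `n`-th power of a word. -/
def wordPow (w : Word) : ℕ → Word
  | 0 => []
  | n + 1 => w ++ wordPow w n

/-- The inverse of a word. -/
def wordInv (w : Word) : Word := (w.map fun a => (a.1, !a.2)).reverse

/-- The conjugate of the word `w` by the word `c`. -/
def wordConj (c w : Word) : Word := wordInv c ++ (w ++ c)

/-- A test for `w` to represent a positive element: with `n` the length of `w`, the element
`w * Δ ^ n` is positive, and it is tested whether it is divisible by `Δ ^ n`. -/
def IsPos (T : List (ℕ × ℕ × ℕ)) (w : Word) : Prop :=
  act T (wordPow [(deltaIndex T, false)] w.length)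
    (act T w (act T (wordPow [(deltaIndex T, true)] w.length) [[]])) ≠ []

instance (T : List (ℕ × ℕ × ℕ)) (w : Word) : Decidable (IsPos T w) := by
  unfold IsPos; infer_instance

/-- The letters of the words over the listed elements. -/
def letters (T : List (ℕ × ℕ × ℕ)) : List (ℕ × Bool) :=
  T.flatMap fun α => [(α.1, true), (α.1, false)]

/-- The words of length `n` with letters in `A`. -/
def words (A : List (ℕ × Bool)) : ℕ → List Word
  | 0 => [[]]
  | n + 1 => (words A n).flatMap fun p => A.map fun a => a :: p

/-- A word for `Δ ^ (r - R)`. -/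
def deltaWord (T : List (ℕ × ℕ × ℕ)) (R r : ℕ) : Word :=
  wordPow [(deltaIndex T, false)] R ++ wordPow [(deltaIndex T, true)] r

/-- No conjugate of `w` by a word from `W` has a larger `inf` than `v` in the range `[-R, R]`. -/
def IsSummit (T : List (ℕ × ℕ × ℕ)) (W : List Word) (R : ℕ) (w v : Word) : Prop :=
  ∀ c ∈ W, ∀ r < 2 * R + 1,
    IsPos T (deltaWord T R r ++ wordConj c w) → IsPos T (deltaWord T R r ++ v)

instance (T : List (ℕ × ℕ × ℕ)) (W : List Word) (R : ℕ) (w v : Word) :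
    Decidable (IsSummit T W R w v) := by
  unfold IsSummit; infer_instance

/-- The powers of `v` and of its inverse with exponents up to the length of the table pass the test
`IsSummit`. -/
def IsStable (T : List (ℕ × ℕ × ℕ)) (W : List Word) (R : ℕ) (w v : Word) : Prop :=
  ∀ n < T.length, IsSummit T W R (wordPow w (n + 1)) (wordPow v (n + 1)) ∧
    IsSummit T W R (wordPow (wordInv w) (n + 1)) (wordPow (wordInv v) (n + 1))

instance (T : List (ℕ × ℕ × ℕ)) (W : List Word) (R : ℕ) (w v : Word) :
    Decidable (IsStable T W R w v) := by
  unfold IsStable; infer_instance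

/-- Keep one word for each represented element. -/
def dedupWords (T : List (ℕ × ℕ × ℕ)) (V : List Word) : List Word :=
  V.foldr (fun v acc =>
    if ∃ u ∈ acc, IsPos T (wordInv u ++ v) ∧ IsPos T (wordInv v ++ u) then acc else v :: acc) []

/-- All powers of the input that matter are bounded by this power of `Δ`. -/
def boundExponent (T : List (ℕ × ℕ × ℕ)) (w : Word) : ℕ := T.length * w.length

/-- Words that suffice for conjugating bounded elements to each other. -/
def conjugators (T : List (ℕ × ℕ × ℕ)) (R : ℕ) : List Word :=
  words (letters T) (words (letters T) (2 * R)).length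

/-- Words for the elements of the stable super summit set. -/
def stableSummitWords (T : List (ℕ × ℕ × ℕ)) (w : Word) : List Word :=
  dedupWords T <| ((conjugators T (boundExponent T w)).map fun c => wordConj c w).filter fun v =>
    IsStable T (conjugators T (boundExponent T w)) (boundExponent T w) w v

/-! ### Words -/

section Words

theorem mem_words {A : List (ℕ × Bool)} {n : ℕ} {w : Word} :
    w ∈ words A n ↔ w.length = n ∧ ∀ a ∈ w, a ∈ A := by
  induction n generalizing w with
  | zero =>
    simp only [words, List.mem_singleton, List.length_eq_zero_iff]
    exact ⟨by rintro rfl; simp, And.left⟩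
  | succ n ih =>
    simp only [words, List.mem_flatMap, List.mem_map, ih]
    constructor
    · rintro ⟨p, ⟨h1, h2⟩, a, ha, rfl⟩
      refine ⟨by simp [h1], fun b hb => ?_⟩
      rcases List.mem_cons.1 hb with rfl | hb
      exacts [ha, h2 b hb]
    · rintro ⟨h1, h2⟩
      rcases w with _ | ⟨a, p⟩
      · simp at h1
      · exact ⟨p, ⟨by simpa using h1, fun b hb => h2 b (by simp [hb])⟩, a, h2 a (by simp), rfl⟩

variable {G : Type*} {s : List G}

theorem IsWordOver.append {v w : Word} (hv : IsWordOver s v) (hw : IsWordOver s w) :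
    IsWordOver s (v ++ w) := fun a ha => (List.mem_append.1 ha).elim (hv a) (hw a)

theorem IsWordOver.inv {w : Word} (hw : IsWordOver s w) : IsWordOver s (wordInv w) := by
  intro a ha
  obtain ⟨b, hb, rfl⟩ : ∃ b ∈ w, (b.1, !b.2) = a := by simpa [wordInv] using ha
  exact hw b hb

theorem IsWordOver.conj {c w : Word} (hc : IsWordOver s c) (hw : IsWordOver s w) :
    IsWordOver s (wordConj c w) := hc.inv.append (hw.append hc)

theorem IsWordOver.pow {w : Word} (hw : IsWordOver s w) (n : ℕ) : IsWordOver s (wordPow w n) := by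
  induction n with
  | zero => simp [wordPow, IsWordOver]
  | succ n ih => exact hw.append ih

theorem isWordOver_singleton {a : ℕ × Bool} (ha : a.1 < s.length) : IsWordOver s [a] := by
  simpa [IsWordOver] using ha

theorem isWordOver_cons {a : ℕ × Bool} {w : Word} :
    IsWordOver s (a :: w) ↔ a.1 < s.length ∧ IsWordOver s w := by
  simp [IsWordOver]

variable [Group G]

theorem wordEval_nil : wordEval s [] = 1 := rfl

theorem wordEval_cons (a : ℕ × Bool) (w : Word) : wordEval s (a :: w) =
    (if a.2 = true then s.getD a.1 1 else (s.getD a.1 1)⁻¹) * wordEval s w := by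
  simp [wordEval]

theorem wordEval_append (v w : Word) : wordEval s (v ++ w) = wordEval s v * wordEval s w := by
  simp [wordEval]

theorem wordEval_inv (w : Word) : wordEval s (wordInv w) = (wordEval s w)⁻¹ := by
  induction w with
  | nil => simp [wordInv, wordEval]
  | cons a w ih =>
    have : wordInv (a :: w) = wordInv w ++ [(a.1, !a.2)] := by simp [wordInv]
    rw [this, wordEval_append, ih, wordEval_cons, wordEval_cons, wordEval_nil]
    rcases a with ⟨i, _ | _⟩ <;> simp

theorem wordEval_conj (c w : Word) :
    wordEval s (wordConj c w) = (wordEval s c)⁻¹ * wordEval s w * wordEval s c := by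
  simp [wordConj, wordEval_append, wordEval_inv, mul_assoc]

theorem wordEval_pow (w : Word) (n : ℕ) : wordEval s (wordPow w n) = wordEval s w ^ n := by
  induction n with
  | zero => simp [wordPow, wordEval]
  | succ n ih => rw [wordPow, wordEval_append, ih, pow_succ']

theorem length_wordPow (w : Word) (n : ℕ) : (wordPow w n).length = n * w.length := by
  induction n with
  | zero => simp [wordPow]
  | succ n ih => rw [wordPow, List.length_append, ih]; ring

theorem length_wordInv (w : Word) : (wordInv w).length = w.length := by simp [wordInv]

end Words

/-! ### Correctness -/

section Correctness

variable {G : Type*} [Group G] {P : Submonoid G} {Δ : P} {s : List G} {T : List (ℕ × ℕ × ℕ)}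

theorem IsProductTable.mem_iff (hT : IsProductTable s T) {i j k : ℕ} : (i, j, k) ∈ T ↔
    i < s.length ∧ j < s.length ∧ k < s.length ∧ s.getD i 1 * s.getD j 1 = s.getD k 1 := by
  rw [hT]
  constructor
  · rintro ⟨a, b, c, ha, hb, hc, rfl⟩
    obtain ⟨hi, rfl⟩ := List.getElem?_eq_some_iff.1 ha
    obtain ⟨hj, rfl⟩ := List.getElem?_eq_some_iff.1 hb
    obtain ⟨hk, hc⟩ := List.getElem?_eq_some_iff.1 hc
    exact ⟨hi, hj, hk, by simp [hi, hj, hk, hc]⟩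
  · rintro ⟨hi, hj, hk, h⟩
    exact ⟨_, _, _, List.getElem?_eq_getElem hi, List.getElem?_eq_getElem hj,
      List.getElem?_eq_getElem hk, by simpa [hi, hj, hk] using h⟩

theorem IsSimpleEnumeration.getD_mem (hs : IsSimpleEnumeration P Δ s) {i : ℕ} (hi : i < s.length) :
    s.getD i 1 ∈ simples P Δ := by
  rw [← hs.2, List.getD_eq_getElem _ _ hi]
  exact List.getElem_mem hi

theorem IsSimpleEnumeration.exists_getD (hs : IsSimpleEnumeration P Δ s) {x : G}
    (hx : x ∈ simples P Δ) : ∃ i, i < s.length ∧ s.getD i 1 = x := by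
  obtain ⟨i, hi, h⟩ := List.getElem_of_mem ((hs.2 x).2 hx)
  exact ⟨i, hi, by rw [List.getD_eq_getElem _ _ hi, h]⟩

/-- The element represented by a positive word. -/
def posEval (s : List G) (p : List ℕ) : G := (p.map fun i => s.getD i 1).prod

theorem posEval_nil : posEval s [] = 1 := rfl

theorem posEval_cons (i : ℕ) (p : List ℕ) : posEval s (i :: p) = s.getD i 1 * posEval s p := by
  simp [posEval]

variable (hG : IsGarsideGroup P Δ) (hs : IsSimpleEnumeration P Δ s) (hT : IsProductTable s T)

include hs in
theorem posEval_mem {p : List ℕ} (hp : ∀ i ∈ p, i < s.length) : posEval s p ∈ P :=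
  P.list_prod_mem fun x hx => by
    obtain ⟨i, hi, rfl⟩ := List.mem_map.1 hx
    exact (mem_simples.1 (hs.getD_mem (hp i hi))).1

include hs hT in
theorem mem_table_fst {i : ℕ} : (∃ α ∈ T, α.1 = i) ↔ i < s.length := by
  constructor
  · rintro ⟨⟨i, j, k⟩, h, rfl⟩
    exact (hT.mem_iff.1 h).1
  · intro hi
    obtain ⟨e, he, he1⟩ := hs.exists_getD one_mem_simples
    exact ⟨(i, e, i), hT.mem_iff.2 ⟨hi, he, hi, by rw [he1, mul_one]⟩, rfl⟩

include hs hT in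
theorem mem_letters {a : ℕ × Bool} : a ∈ letters T ↔ a.1 < s.length := by
  rw [← mem_table_fst hs hT]
  rcases a with ⟨i, _ | _⟩ <;> simp [letters]

include hs hT in
theorem mem_words_letters {n : ℕ} {w : Word} :
    w ∈ words (letters T) n ↔ w.length = n ∧ IsWordOver s w := by
  rw [mem_words]
  simp only [mem_letters hs hT]
  rfl

include hs hT in
-- Multiplication by 1 makes every position the first entry of some triple. The table length thus
-- serves as a computable bound for the exponents to be tested.
theorem length_le_table : s.length ≤ T.length := by
  classical
  have h : Finset.range s.length ⊆ (T.map Prod.fst).toFinset := by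
    intro i hi
    rw [Finset.mem_range, ← mem_table_fst hs hT] at hi
    simpa using hi
  simpa using (Finset.card_le_card h).trans (List.toFinset_card_le _)

include hG hs hT in
theorem deltaIndex_spec : deltaIndex T < s.length ∧ s.getD (deltaIndex T) 1 = Δ := by
  obtain ⟨d, hd, hdΔ⟩ := hs.exists_getD delta_mem_simples
  set L := (T.map Prod.fst).filter fun i => ∀ α ∈ T, ∃ β ∈ T, β.1 = α.1 ∧ β.2.2 = i with hL
  have hdL : d ∈ L := by
    simp only [hL, List.mem_filter, List.mem_map, decide_eq_true_eq]
    refine ⟨(mem_table_fst hs hT).2 hd, ?_⟩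
    rintro ⟨i, j, k⟩ hα
    have hi := (hT.mem_iff.1 hα).1
    obtain ⟨t, ht, ht'⟩ := hs.exists_getD (star_mem_simples hG (hs.getD_mem hi))
    exact ⟨(i, t, d), hT.mem_iff.2 ⟨hi, ht, hd, by rw [ht', hdΔ, mul_inv_cancel_left]⟩, rfl, rfl⟩
  have hmem : deltaIndex T ∈ L := by
    unfold deltaIndex
    rw [← hL]
    cases h : L with
    | nil => simp [h] at hdL
    | cons a l => simp
  generalize deltaIndex T = i at hmem
  simp only [hL, List.mem_filter, List.mem_map, decide_eq_true_eq] at hmem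
  obtain ⟨h1, h2⟩ := hmem
  have hi := (mem_table_fst hs hT).1 h1
  refine ⟨hi, ?_⟩
  -- The test applied to the position of Δ shows that Δ divides the selected simple element, which
  -- in turn divides Δ.
  obtain ⟨α, hα, rfl⟩ := (mem_table_fst hs hT).2 hd
  obtain ⟨⟨a, j, k⟩, hβ, rfl, rfl⟩ := h2 α hα
  obtain ⟨-, hj, -, h3⟩ := hT.mem_iff.1 hβ
  refine GroupLeL.antisymm hG (groupLeL_iff.2 (mem_simples.1 (hs.getD_mem hi)).2) ?_
  rw [← h3, hdΔ]
  exact ⟨_, (mem_simples.1 (hs.getD_mem hj)).1, rfl⟩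

/-- The triple (x, x, x) says that the element at `x` is idempotent, which in a group identifies the
identity. -/
theorem mem_quotients_nil {x : ℕ} {p' : List ℕ} :
    (x, p') ∈ quotients T [] ↔ (x, x, x) ∈ T ∧ p' = [] := by
  simp only [quotients, List.foldr_nil, List.mem_map, List.mem_filter, decide_eq_true_eq]
  constructor
  · rintro ⟨⟨i, j, k⟩, ⟨h, h1, h2⟩, h'⟩
    simp only [Prod.mk.injEq] at h' h1 h2
    obtain ⟨rfl, rfl⟩ := h'
    subst h1 h2
    exact ⟨h, rfl⟩
  · rintro ⟨h, rfl⟩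
    exact ⟨_, ⟨h, rfl, rfl⟩, rfl⟩

theorem mem_quotients_cons {i x : ℕ} {p p' : List ℕ} :
    (x, p') ∈ quotients T (i :: p) ↔ ∃ t q u m, (t, q) ∈ quotients T p ∧ (i, t, m) ∈ T ∧
      (x, u, m) ∈ T ∧ p' = u :: q := by
  have : quotients T (i :: p) = (quotients T p).flatMap fun r => T.flatMap fun α =>
      T.flatMap fun β => quotientStep i r α β := rfl
  rw [this]
  simp only [List.mem_flatMap, quotientStep]
  constructor
  · rintro ⟨⟨t, q⟩, h1, ⟨a, b, m⟩, h2, ⟨a', u, m'⟩, h3, h4⟩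
    split_ifs at h4 with h5
    · simp only [List.mem_singleton, Prod.mk.injEq] at h4 h5
      obtain ⟨rfl, rfl, rfl⟩ := h5
      obtain ⟨rfl, rfl⟩ := h4
      exact ⟨_, _, _, _, h1, h2, h3, rfl⟩
    · simp at h4
  · rintro ⟨t, q, u, m, h1, h2, h3, rfl⟩
    exact ⟨_, h1, _, h2, _, h3, by simp⟩

include hT in
theorem quotients_sound {p : List ℕ} {x : ℕ} {p' : List ℕ} (h : (x, p') ∈ quotients T p) :
    (∀ i ∈ p', i < s.length) ∧ s.getD x 1 * posEval s p' = posEval s p := by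
  induction p generalizing x p' with
  | nil =>
    rw [mem_quotients_nil, hT.mem_iff] at h
    obtain ⟨⟨-, -, -, h1⟩, rfl⟩ := h
    rw [mul_eq_left] at h1
    exact ⟨by simp, by rw [h1, posEval_nil, mul_one]⟩
  | cons i p ih =>
    obtain ⟨t, q, u, m, h1, h2, h3, rfl⟩ := mem_quotients_cons.1 h
    obtain ⟨h4, h5⟩ := ih h1
    rw [hT.mem_iff] at h2 h3
    refine ⟨?_, ?_⟩
    · intro j hj
      rcases List.mem_cons.1 hj with rfl | hj
      exacts [h3.2.1, h4 j hj]
    · rw [posEval_cons, posEval_cons, ← h5, ← mul_assoc, ← mul_assoc, h3.2.2.2, h2.2.2.2]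

include hG hs hT in
-- The table records only products that are simple. Completeness rests on the fact that divisibility
-- is always witnessed by a simple common multiple.
theorem quotients_complete {p : List ℕ} (hp : ∀ i ∈ p, i < s.length) {x : ℕ} (hx : x < s.length)
    (h : (s.getD x 1)⁻¹ * posEval s p ∈ P) : ∃ p', (x, p') ∈ quotients T p := by
  induction p generalizing x with
  | nil =>
    have h1 := eq_one_of_inv_mem hG (mem_simples.1 (hs.getD_mem hx)).1
      (by simpa [posEval_nil] using h)
    exact ⟨[], mem_quotients_nil.2 ⟨hT.mem_iff.2 ⟨hx, hx, hx, by rw [h1, mul_one]⟩, rfl⟩⟩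
  | cons i p ih =>
    have hp' : ∀ i ∈ p, i < s.length := fun j hj => hp j (by simp [hj])
    rw [posEval_cons] at h
    obtain ⟨u, hu, t, ht, hst, h1, h2⟩ := exists_simple_complement hG (hs.getD_mem hx)
      (hs.getD_mem (hp i (by simp))) (posEval_mem hs hp') h
    obtain ⟨u, hu', rfl⟩ := hs.exists_getD hu
    obtain ⟨t, ht', rfl⟩ := hs.exists_getD ht
    obtain ⟨m, hm, hm'⟩ := hs.exists_getD hst
    obtain ⟨q, hq⟩ := ih hp' ht' h2
    exact ⟨u :: q, mem_quotients_cons.2 ⟨t, q, u, m, hq,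
      hT.mem_iff.2 ⟨hp i (by simp), ht', hm, hm'.symm⟩,
      hT.mem_iff.2 ⟨hx, hu', hm, by rw [h1, hm']⟩, rfl⟩⟩

/-- All words in `C` represent `g`. -/
def Represents (s : List G) (C : List (List ℕ)) (g : G) : Prop :=
  ∀ p ∈ C, (∀ i ∈ p, i < s.length) ∧ posEval s p = g

include hT in
theorem Represents.actLetter {C : List (List ℕ)} {g : G} (h : Represents s C g) {a : ℕ × Bool}
    (ha : a.1 < s.length) : Represents s (actLetter T a C) (wordEval s [a] * g) := by
  intro p hp
  rw [wordEval_cons, wordEval_nil, mul_one]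
  unfold Garside.actLetter at hp
  split_ifs at hp ⊢ with hb
  · obtain ⟨q, hq, rfl⟩ := List.mem_map.1 hp
    obtain ⟨h1, h2⟩ := h q hq
    refine ⟨fun i hi => ?_, by rw [posEval_cons, h2]⟩
    rcases List.mem_cons.1 hi with rfl | hi
    exacts [ha, h1 i hi]
  · obtain ⟨q, hq, hp⟩ := List.mem_flatMap.1 hp
    simp only [List.mem_map, List.mem_filter, decide_eq_true_eq] at hp
    obtain ⟨⟨x, p⟩, ⟨h1, rfl⟩, rfl⟩ := hp
    obtain ⟨h2, h3⟩ := quotients_sound hT h1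
    refine ⟨h2, ?_⟩
    rw [← (h q hq).2, ← h3]
    simp

include hT in
theorem Represents.act {C : List (List ℕ)} {g : G} (h : Represents s C g) {w : Word}
    (hw : IsWordOver s w) : Represents s (act T w C) (wordEval s w * g) := by
  induction w with
  | nil => simpa [Garside.act, wordEval_nil] using h
  | cons a w ih =>
    rw [isWordOver_cons] at hw
    have := (ih hw.2).actLetter hT hw.1
    rwa [← mul_assoc, ← wordEval_append] at this

include hG hs hT in
theorem Represents.actLetter_ne_nil {C : List (List ℕ)} {g : G} (h : Represents s C g)
    (hC : C ≠ []) {a : ℕ × Bool} (ha : a.1 < s.length) (hpos : wordEval s [a] * g ∈ P) :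
    Garside.actLetter T a C ≠ [] := by
  obtain ⟨q, hq⟩ := List.exists_mem_of_ne_nil C hC
  rw [wordEval_cons, wordEval_nil, mul_one] at hpos
  unfold Garside.actLetter
  split_ifs at hpos ⊢ with hb
  · simpa using hC
  · obtain ⟨h1, rfl⟩ := h q hq
    obtain ⟨p', hp'⟩ := quotients_complete hG hs hT h1 ha hpos
    refine List.ne_nil_of_mem (a := p') (List.mem_flatMap.2 ⟨q, hq, ?_⟩)
    simp only [List.mem_map, List.mem_filter, decide_eq_true_eq]
    exact ⟨_, ⟨hp', rfl⟩, rfl⟩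

include hG hs hT in
-- Quotients that are not positive are dropped, so survival requires positivity after each letter,
-- that is, for every suffix of the word.
theorem Represents.act_ne_nil {C : List (List ℕ)} {g : G} (h : Represents s C g)
    (hC : C ≠ []) {w : Word} (hw : IsWordOver s w)
    (hpos : ∀ u, u <:+ w → wordEval s u * g ∈ P) : Garside.act T w C ≠ [] := by
  induction w with
  | nil => simpa [Garside.act] using hC
  | cons a w ih =>
    rw [isWordOver_cons] at hw
    refine (h.act hT hw.2).actLetter_ne_nil hG hs hT
      (ih hw.2 fun u hu => hpos u (hu.trans (List.suffix_cons a w))) hw.1 ?_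
    rw [← mul_assoc, ← wordEval_append]
    exact hpos _ (List.suffix_refl _)

include hG hs in
theorem isBounded_wordEval {w : Word} (hw : IsWordOver s w) :
    IsBounded P Δ w.length (wordEval s w) := by
  induction w with
  | nil => exact ⟨by simpa [wordEval_nil] using GroupLeL.refl _,
      by simpa [wordEval_nil] using GroupLeL.refl _⟩
  | cons a w ih =>
    rw [isWordOver_cons] at hw
    have h1 := isBounded_of_mem_simples (hs.getD_mem hw.1)
    rw [wordEval_cons, List.length_cons, add_comm]
    refine IsBounded.mul hG ?_ (ih hw.2)
    split_ifs
    exacts [h1, h1.inv hG]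

theorem wordPow_singleton (a : ℕ × Bool) (n : ℕ) : wordPow [a] n = List.replicate n a := by
  induction n with
  | zero => rfl
  | succ n ih => rw [wordPow, ih, List.replicate_succ, List.singleton_append]

include hG hs hT in
theorem wordEval_deltaWord (R r : ℕ) :
    wordEval s (deltaWord T R r) = (Δ : G) ^ (-((R : ℤ) - r)) := by
  rw [deltaWord, wordEval_append, wordEval_pow, wordEval_pow, wordEval_cons, wordEval_cons,
    wordEval_nil]
  simp only [(deltaIndex_spec hG hs hT).2, Bool.false_eq_true, if_false, if_true, mul_one]
  rw [neg_sub, sub_eq_neg_add, zpow_add, zpow_neg, zpow_natCast, zpow_natCast, inv_pow]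

include hG hs hT in
theorem isWordOver_deltaWord (R r : ℕ) : IsWordOver s (deltaWord T R r) :=
  have h := (deltaIndex_spec hG hs hT).1
  ((isWordOver_singleton h).pow R).append ((isWordOver_singleton h).pow r)

include hG hs hT in
-- The initial factor Δ^n keeps all intermediate products of the word positive. The final division
-- by Δ^n leaves Δ^(-n) w Δ^n, which is positive exactly when `w` is.
theorem isPos_iff {w : Word} (hw : IsWordOver s w) : IsPos T w ↔ wordEval s w ∈ P := by
  obtain ⟨hd, hdΔ⟩ := deltaIndex_spec hG hs hT
  have hword : ∀ b n, IsWordOver s (wordPow [(deltaIndex T, b)] n) := fun b n =>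
    IsWordOver.pow (isWordOver_singleton hd) n
  have hev1 : ∀ n, wordEval s (wordPow [(deltaIndex T, true)] n) = (Δ : G) ^ (n : ℤ) := fun n => by
    simpa [deltaWord, wordPow] using wordEval_deltaWord hG hs hT 0 n
  have hev2 : ∀ n, wordEval s (wordPow [(deltaIndex T, false)] n) = (Δ : G) ^ (-(n : ℤ)) :=
    fun n => by simpa [deltaWord, wordPow] using wordEval_deltaWord hG hs hT n 0
  set n := w.length with hn
  have h0 : Represents s [[]] (1 : G) := by simp [Represents, posEval_nil]
  have h1 := h0.act hT (hword true n)
  have h2 := h1.act hT hw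
  have h3 := h2.act hT (hword false n)
  rw [hev1, mul_one] at h1 h2 h3
  rw [hev2, ← mul_assoc] at h3
  constructor
  · intro h
    obtain ⟨p, hp⟩ := List.exists_mem_of_ne_nil _ h
    obtain ⟨hp1, hp2⟩ := h3 p hp
    have := posEval_mem hs hp1
    rwa [hp2, conj_zpow_mem_iff hG] at this
  · intro h
    refine h2.act_ne_nil hG hs hT (h1.act_ne_nil hG hs hT
      (h0.act_ne_nil hG hs hT (by simp) (hword _ _) ?_) hw ?_) (hword _ _) ?_
    · rw [wordPow_singleton]
      intro u hu
      obtain ⟨-, hu⟩ := List.suffix_replicate_iff.1 hu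
      rw [hu, ← wordPow_singleton, hev1, mul_one, zpow_natCast]
      exact P.pow_mem Δ.2 _
    · rintro u hu
      have h4 := ((isBounded_wordEval hG hs fun a ha => hw a (hu.subset ha)).mono hu.length_le).1
      have h5 := h4.mul_zpow hG (n : ℤ)
      rw [← zpow_add, neg_add_cancel, zpow_zero] at h5
      exact one_groupLeL_iff.1 h5
    · rw [wordPow_singleton]
      intro u hu
      obtain ⟨hle, hu⟩ := List.suffix_replicate_iff.1 hu
      rw [hu, ← wordPow_singleton, hev2, ← mul_assoc]
      -- After k of the n divisions the product is (Δ^(-k) w Δ^k) Δ^(n-k), a product of positive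
      -- elements.
      have h4 := P.mul_mem (conj_zpow_mem hG h u.length)
        (show (Δ : G) ^ ((n : ℤ) - u.length) ∈ P from ?_)
      · rwa [mul_assoc, ← zpow_add, add_sub_cancel] at h4
      · rw [← Nat.cast_sub hle, zpow_natCast]
        exact P.pow_mem Δ.2 _

end Correctness

/-! ### Correctness of the bounded searches and of the output list -/

section Output

variable {G : Type*} [Group G] {P : Submonoid G} {Δ : P} {s : List G} {T : List (ℕ × ℕ × ℕ)}

theorem exists_word (hs : IsSimpleEnumeration P Δ s) {l : List G}
    (hl : ∀ u ∈ l, u ∈ simples P Δ ∨ u⁻¹ ∈ simples P Δ) :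
    ∃ c : Word, c.length = l.length ∧ IsWordOver s c ∧ wordEval s c = l.prod := by
  induction l with
  | nil => exact ⟨[], rfl, by simp [IsWordOver], rfl⟩
  | cons u l ih =>
    obtain ⟨c, h1, h2, h3⟩ := ih fun z hz => hl z (by simp [hz])
    rcases hl u (by simp) with hu | hu
    · obtain ⟨i, hi, hiu⟩ := hs.exists_getD hu
      exact ⟨(i, true) :: c, by simp [h1], isWordOver_cons.2 ⟨hi, h2⟩, by
        rw [wordEval_cons, h3, List.prod_cons, if_pos rfl, hiu]⟩
    · obtain ⟨i, hi, hiu⟩ := hs.exists_getD hu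
      exact ⟨(i, false) :: c, by simp [h1], isWordOver_cons.2 ⟨hi, h2⟩, by
        rw [wordEval_cons, h3, List.prod_cons, if_neg (by simp), hiu, inv_inv]⟩

variable (hG : IsGarsideGroup P Δ) (hs : IsSimpleEnumeration P Δ s) (hT : IsProductTable s T)
include hG hs hT

/-- Every bounded element is Δ^R times the inverse of a positive word of length 2R, so the number of
words of that length bounds the length of a path. -/
theorem exists_conjugator {R : ℕ} {x y : G} (hx : IsBounded P Δ R x) (hy : IsBounded P Δ R y)
    (h : y ∈ conjClass x) :
    ∃ c ∈ conjugators T R, y = (wordEval s c)⁻¹ * x * wordEval s c := by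
  classical
  let F : Finset G :=
    ((words (letters T) (2 * R)).map fun d => (Δ : G) ^ (R : ℤ) * (wordEval s d)⁻¹).toFinset
  have hF : ∀ x, IsBounded P Δ R x → x ∈ F := by
    intro x hx
    obtain ⟨l, h1, h2, h3⟩ := hx.exists_list hG
    obtain ⟨c, h4, h5, h6⟩ := exists_word hs fun u hu => Or.inl (h2 u hu)
    simp only [F, List.mem_toFinset, List.mem_map]
    exact ⟨c, (mem_words_letters hs hT).2 ⟨h4.trans h1, h5⟩, by rw [h6, h3]; simp⟩
  have hFB : F.card ≤ (words (letters T) (2 * R)).length := by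
    simpa [F] using List.toFinset_card_le
      ((words (letters T) (2 * R)).map fun d => (Δ : G) ^ (R : ℤ) * (wordEval s d)⁻¹)
  obtain ⟨l, h1, h2, h3⟩ := exists_short_conj hG hF hFB hx hy h
  obtain ⟨c, h4, h5, h6⟩ := exists_word hs h2
  exact ⟨c, (mem_words_letters hs hT).2 ⟨h4.trans h1, h5⟩, by rw [h6, h3]⟩

theorem isPos_deltaWord_iff {R r : ℕ} {w : Word} (hw : IsWordOver s w) :
    IsPos T (deltaWord T R r ++ w) ↔ GroupLeL P ((Δ : G) ^ ((R : ℤ) - r)) (wordEval s w) := by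
  rw [isPos_iff hG hs hT ((isWordOver_deltaWord hG hs hT R r).append hw), wordEval_append,
    wordEval_deltaWord hG hs hT, groupLeL_iff, zpow_neg]

theorem isSummit_iff {R : ℕ} {w v : Word} (hw : IsWordOver s w) (hv : IsWordOver s v)
    (hR : w.length ≤ R) : IsSummit T (conjugators T R) R w v ↔
      ∀ r, InfAtLeast P Δ (wordEval s w) r → GroupLeL P ((Δ : G) ^ r) (wordEval s v) := by
  have hconj : ∀ c ∈ conjugators T R, IsWordOver s c := fun c hc =>
    ((mem_words_letters hs hT).1 hc).2
  constructor
  · intro H r hr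
    by_cases hΔ : (Δ : G) = 1
    · have := subsingleton_of_delta_eq_one hG hΔ
      rw [Subsingleton.elim (_ ^ r) (wordEval s v)]
      exact GroupLeL.refl _
    have hb := (isBounded_wordEval hG hs hw).mono hR
    -- Exponents below -R may be raised to -R, a bound that `w` itself satisfies; exponents above R
    -- cannot occur once the conjugate is kept below Δ^R.
    obtain ⟨k, hrk, hRk, hk⟩ : ∃ k, r ≤ k ∧ -(R : ℤ) ≤ k ∧ InfAtLeast P Δ (wordEval s w) k := by
      rcases le_total r (-(R : ℤ)) with h | h
      · exact ⟨_, h, le_rfl, _, self_mem_conjClass _, hb.1⟩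
      · exact ⟨r, le_rfl, h, hr⟩
    obtain ⟨x, hx, hx1, hx2⟩ := hk.exists_le hG hb.2
    have hkR : k ≤ R := le_of_delta_zpow_groupLeL hG hΔ (hx1.trans hx2)
    obtain ⟨c, hc, hxc⟩ := exists_conjugator hG hs hT hb
      (⟨(delta_zpow_groupLeL hRk).trans hx1, hx2⟩ : IsBounded P Δ R x) hx
    have h1 := H c hc ((R : ℤ) - k).toNat (by omega)
    rw [isPos_deltaWord_iff hG hs hT ((hconj c hc).conj hw), isPos_deltaWord_iff hG hs hT hv,
      wordEval_conj, ← hxc, Int.toNat_of_nonneg (by omega), sub_sub_cancel] at h1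
    exact (delta_zpow_groupLeL hrk).trans (h1 hx1)
  · intro H c hc r _ h1
    rw [isPos_deltaWord_iff hG hs hT ((hconj c hc).conj hw), wordEval_conj] at h1
    rw [isPos_deltaWord_iff hG hs hT hv]
    exact H _ ⟨_, ⟨_, rfl⟩, h1⟩

/-- Antisymmetry of the order reduces the word problem to two positivity tests. -/
theorem isPos_and_iff {u v : Word} (hu : IsWordOver s u) (hv : IsWordOver s v) :
    IsPos T (wordInv u ++ v) ∧ IsPos T (wordInv v ++ u) ↔ wordEval s u = wordEval s v := by
  rw [isPos_iff hG hs hT (hu.inv.append hv), isPos_iff hG hs hT (hv.inv.append hu),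
    wordEval_append, wordEval_append, wordEval_inv, wordEval_inv, ← groupLeL_iff, ← groupLeL_iff]
  exact ⟨fun h => h.1.antisymm hG h.2, fun h => by rw [h]; exact ⟨GroupLeL.refl _, GroupLeL.refl _⟩⟩

theorem dedupWords_spec {V : List Word} (hV : ∀ v ∈ V, IsWordOver s v) :
    (∀ v ∈ dedupWords T V, v ∈ V) ∧ ((dedupWords T V).map (wordEval s)).Nodup ∧
      ∀ v ∈ V, ∃ u ∈ dedupWords T V, wordEval s u = wordEval s v := by
  induction V with
  | nil => simp [dedupWords]
  | cons v V ih =>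
    obtain ⟨h1, h2, h3⟩ := ih fun u hu => hV u (by simp [hu])
    have hv := hV v (by simp)
    have hE : (∃ u ∈ dedupWords T V, IsPos T (wordInv u ++ v) ∧ IsPos T (wordInv v ++ u)) ↔
        wordEval s v ∈ (dedupWords T V).map (wordEval s) := by
      rw [List.mem_map]
      exact exists_congr fun u => and_congr_right fun hu =>
        isPos_and_iff hG hs hT (hV u (by simp [h1 u hu])) hv
    have hdef : dedupWords T (v :: V) =
        if ∃ u ∈ dedupWords T V, IsPos T (wordInv u ++ v) ∧ IsPos T (wordInv v ++ u) then
          dedupWords T V else v :: dedupWords T V := rfl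
    rw [hdef]
    split_ifs with h
    · refine ⟨fun u hu => by simp [h1 u hu], h2, fun u hu => ?_⟩
      rcases List.mem_cons.1 hu with rfl | hu
      · simpa using hE.1 h
      · exact h3 u hu
    · refine ⟨fun u hu => ?_, ?_, fun u hu => ?_⟩
      · rcases List.mem_cons.1 hu with rfl | hu
        · simp
        · simp [h1 u hu]
      · rw [List.map_cons, List.nodup_cons]
        exact ⟨fun h' => h (hE.2 h'), h2⟩
      · rcases List.mem_cons.1 hu with rfl | hu
        · exact ⟨u, by simp, rfl⟩
        · obtain ⟨z, hz, hzu⟩ := h3 u hu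
          exact ⟨z, by simp [hz], hzu⟩

theorem stableSummitWords_spec {w : Word} (hw : IsWordOver s w) :
    (∀ v ∈ stableSummitWords T w, IsWordOver s v) ∧
      ((stableSummitWords T w).map (wordEval s)).Nodup ∧
      {h : G | h ∈ (stableSummitWords T w).map (wordEval s)} =
        stableSuperSummitSet P Δ (wordEval s w) := by
  classical
  set R := boundExponent T w with hR
  set V := ((conjugators T R).map fun c => wordConj c w).filter fun v =>
    IsStable T (conjugators T R) R w v with hVdef
  have hconj : ∀ c ∈ conjugators T R, IsWordOver s c := fun c hc =>
    ((mem_words_letters hs hT).1 hc).2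
  have hV : ∀ v ∈ V, IsWordOver s v := by
    intro v hv
    obtain ⟨c, hc, rfl⟩ := List.mem_map.1 (List.mem_filter.1 hv).1
    exact (hconj c hc).conj hw
  -- The bound is chosen so that it covers all tested powers of the input and of its inverse.
  have hlen : ∀ {u : Word} {n : ℕ}, u.length = w.length → n < T.length →
      (wordPow u (n + 1)).length ≤ R := by
    intro u n hu hn
    rw [length_wordPow, hu, hR, boundExponent]
    exact Nat.mul_le_mul_right _ hn
  have hstable : ∀ v, IsWordOver s v → wordEval s v ∈ conjClass (wordEval s w) →
      (IsStable T (conjugators T R) R w v ↔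
        wordEval s v ∈ stableSuperSummitSet P Δ (wordEval s w)) := by
    intro v hv hvw
    rw [mem_stableSuperSummitSet_iff hG (S := s.toFinset)
      (fun x hx => List.mem_toFinset.2 ((hs.2 x).2 hx))
      ((List.toFinset_card_le s).trans (length_le_table hs hT)), and_iff_right hvw]
    have key : ∀ n < T.length, (IsSummit T (conjugators T R) R (wordPow w (n + 1))
        (wordPow v (n + 1)) ∧ IsSummit T (conjugators T R) R (wordPow (wordInv w) (n + 1))
        (wordPow (wordInv v) (n + 1))) ↔ (∀ r, InfAtLeast P Δ (wordEval s w ^ (n + 1)) r →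
          GroupLeL P ((Δ : G) ^ r) (wordEval s v ^ (n + 1))) ∧
        ∀ r, InfAtLeast P Δ ((wordEval s w)⁻¹ ^ (n + 1)) r →
          GroupLeL P ((Δ : G) ^ r) ((wordEval s v)⁻¹ ^ (n + 1)) := by
      intro n hn
      rw [isSummit_iff hG hs hT (hw.pow _) (hv.pow _) (hlen rfl hn),
        isSummit_iff hG hs hT (hw.inv.pow _) (hv.inv.pow _) (hlen (length_wordInv w) hn)]
      simp only [wordEval_pow, wordEval_inv]
    constructor
    · intro H n h1 h2
      obtain ⟨n, rfl⟩ := Nat.exists_eq_add_of_le' h1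
      exact (key n h2).1 (H n h2)
    · exact fun H n hn => (key n hn).2 (H (n + 1) (by omega) hn)
  obtain ⟨h1, h2, h3⟩ := dedupWords_spec hG hs hT hV
  refine ⟨fun v hv => hV v (h1 v hv), h2, Set.ext fun h => ?_⟩
  rw [Set.mem_ofPred_eq, List.mem_map]
  constructor
  · rintro ⟨v, hv, rfl⟩
    have hvV := h1 v hv
    obtain ⟨hc, hst⟩ := List.mem_filter.1 hvV
    obtain ⟨c, hc, rfl⟩ := List.mem_map.1 hc
    exact (hstable _ (hV _ hvV) ⟨wordEval s c, wordEval_conj c w⟩).1 (by simpa using hst)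
  · intro hh
    have hT1 : 1 ≤ T.length := by
      obtain ⟨i, hi, -⟩ := hs.exists_getD one_mem_simples
      exact (Nat.zero_le i).trans_lt (hi.trans_le (length_le_table hs hT))
    have hbw : IsBounded P Δ R (wordEval s w) :=
      (isBounded_wordEval hG hs hw).mono (Nat.le_mul_of_pos_left _ hT1)
    obtain ⟨hhw, hi, hsup⟩ := (mem_superSummitSet_iff hG).1 hh.1
    -- The input is a competitor in its own class, so a summit element has at least as good bounds
    -- on both sides.
    have hbh : IsBounded P Δ R h := by
      refine ⟨hi _ ⟨_, self_mem_conjClass _, hbw.1⟩, ?_⟩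
      rw [← groupLeL_inv_iff hG]
      exact hsup _ ⟨_, self_mem_conjClass _, (hbw.inv hG).1⟩
    obtain ⟨c, hc, hhc⟩ := exists_conjugator hG hs hT hbw hbh hhw
    rw [← wordEval_conj] at hhc
    have hcw := (hconj c hc).conj hw
    have hmem : wordConj c w ∈ V := by
      rw [hVdef, List.mem_filter]
      refine ⟨List.mem_map.2 ⟨c, hc, rfl⟩, ?_⟩
      simpa using (hstable _ hcw (hhc ▸ hhw)).2 (hhc ▸ hh)
    obtain ⟨u, hu, huv⟩ := h3 _ hmem
    exact ⟨u, hu, huv.trans hhc.symm⟩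

end Output

/-! ### Computability -/

section Primrec

open Primrec

/-- Primitive recursive relations are closed under quantification over the members of a list. Nested
quantifiers are treated from the inside out, with the free variables carried along in tuples. -/
theorem primrec_deltaIndex : Primrec deltaIndex := by
  have h0 : PrimrecRel fun (β : ℕ × ℕ × ℕ) (q : ℕ × ℕ) => β.1 = q.1 ∧ β.2.2 = q.2 :=
    (Primrec.eq.comp (fst.comp fst) (fst.comp snd)).and
      (Primrec.eq.comp (snd.comp (snd.comp fst)) (snd.comp snd))
  have h1 : PrimrecRel fun (α : ℕ × ℕ × ℕ) (q : List (ℕ × ℕ × ℕ) × ℕ) =>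
      ∃ β ∈ q.1, β.1 = α.1 ∧ β.2.2 = q.2 :=
    h0.exists_mem_list.comp (fst.comp snd) (pair (fst.comp fst) (snd.comp snd))
  have h2 : PrimrecRel fun (i : ℕ) (T : List (ℕ × ℕ × ℕ)) =>
      ∀ α ∈ T, ∃ β ∈ T, β.1 = α.1 ∧ β.2.2 = i :=
    h1.forall_mem_list.comp snd (pair snd fst)
  exact list_headI.comp <| h2.listFilter.comp (list_map Primrec.id (fst.comp snd).to₂) Primrec.id

theorem primrec_quotientStep : Primrec fun p : (ℕ × ℕ × List ℕ) × (ℕ × ℕ × ℕ) × (ℕ × ℕ × ℕ) =>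
    quotientStep p.1.1 p.1.2 p.2.1 p.2.2 := by
  have h : PrimrecPred fun p : (ℕ × ℕ × List ℕ) × (ℕ × ℕ × ℕ) × (ℕ × ℕ × ℕ) =>
      p.2.1.1 = p.1.1 ∧ p.2.1.2.1 = p.1.2.1 ∧ p.2.2.2.2 = p.2.1.2.2 :=
    (Primrec.eq.comp (fst.comp (fst.comp snd)) (fst.comp fst)).and
      ((Primrec.eq.comp (fst.comp (snd.comp (fst.comp snd))) (fst.comp (snd.comp fst))).and
      (Primrec.eq.comp (snd.comp (snd.comp (snd.comp snd))) (snd.comp (snd.comp (fst.comp snd)))))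
  have h' : Primrec fun p : (ℕ × ℕ × List ℕ) × (ℕ × ℕ × ℕ) × (ℕ × ℕ × ℕ) =>
      [(p.2.2.1, p.2.2.2.1 :: p.1.2.2)] :=
    list_cons.comp (pair (fst.comp (snd.comp snd)) (list_cons.comp
      (fst.comp (snd.comp (snd.comp snd))) (snd.comp (snd.comp fst)))) (Primrec.const [])
  exact Primrec.ite h h' (Primrec.const [])

theorem primrec_quotients : Primrec₂ quotients := by
  have h1 : Primrec₂ fun (q : List (ℕ × ℕ × ℕ) × (ℕ × ℕ × List ℕ)) (α : ℕ × ℕ × ℕ) =>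
      q.1.flatMap fun β => quotientStep q.2.1 q.2.2 α β :=
    list_flatMap (fst.comp fst) (primrec_quotientStep.comp
      (pair (snd.comp (fst.comp fst)) (pair (snd.comp fst) snd)))
  have h2 : Primrec₂ fun (q : (List (ℕ × ℕ × ℕ) × List ℕ) × (ℕ × List (ℕ × List ℕ)))
      (r : ℕ × List ℕ) => q.1.1.flatMap fun α => q.1.1.flatMap fun β =>
        quotientStep q.2.1 r α β := by
    have hf : Primrec fun p : (((List (ℕ × ℕ × ℕ) × List ℕ) × (ℕ × List (ℕ × List ℕ))) ×
        (ℕ × List ℕ)) × (ℕ × ℕ × ℕ) => (p.1.1.1.1, (p.1.1.2.1, p.1.2)) :=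
      pair (fst.comp (fst.comp (fst.comp fst)))
        (pair (fst.comp (snd.comp (fst.comp fst))) (snd.comp fst))
    have h := h1.comp hf snd
    exact list_flatMap (fst.comp (fst.comp fst)) h.to₂
  have h3 : PrimrecPred fun α : ℕ × ℕ × ℕ => α.2.1 = α.1 ∧ α.2.2 = α.1 :=
    (Primrec.eq.comp (fst.comp snd) fst).and (Primrec.eq.comp (snd.comp snd) fst)
  have h4 : Primrec₂ fun (q : List (ℕ × ℕ × ℕ) × List ℕ) (b : ℕ × List (ℕ × List ℕ)) =>
      b.2.flatMap fun r => q.1.flatMap fun α => q.1.flatMap fun β => quotientStep b.1 r α β :=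
    list_flatMap (snd.comp snd) h2
  exact list_foldr snd (list_map ((listFilter h3).comp fst)
    (pair (fst.comp snd) (Primrec.const [])).to₂) h4

theorem primrec_actLetter : Primrec fun q : List (ℕ × ℕ × ℕ) × (ℕ × Bool) × List (List ℕ) =>
    actLetter q.1 q.2.1 q.2.2 := by
  have h0 : PrimrecRel fun (r : ℕ × List ℕ) (x : ℕ) => r.1 = x :=
    Primrec.eq.comp (fst.comp fst) snd
  have hc : PrimrecPred fun q : List (ℕ × ℕ × ℕ) × (ℕ × Bool) × List (List ℕ) =>
      q.2.1.2 = true := Primrec.eq.comp (snd.comp (fst.comp snd)) (Primrec.const true)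
  unfold actLetter
  refine Primrec.ite hc ?_ ?_
  · exact list_map (snd.comp snd) (list_cons.comp (fst.comp (fst.comp (snd.comp fst))) snd)
  · exact list_flatMap (snd.comp snd) (list_map (h0.listFilter.comp
      (primrec_quotients.comp (fst.comp fst) snd) (fst.comp (fst.comp (snd.comp fst))))
      (snd.comp snd))

theorem primrec_act : Primrec fun q : List (ℕ × ℕ × ℕ) × Word × List (List ℕ) =>
    act q.1 q.2.1 q.2.2 := by
  have h : Primrec₂ fun (q : List (ℕ × ℕ × ℕ) × Word × List (List ℕ))
      (b : (ℕ × Bool) × List (List ℕ)) => actLetter q.1 b.1 b.2 :=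
    primrec_actLetter.comp (pair (fst.comp fst) snd)
  exact list_foldr (fst.comp snd) (snd.comp snd) h

theorem primrec_wordPow : Primrec₂ wordPow := by
  refine (nat_rec (f := fun _ : Word => ([] : Word))
    (g := fun w q => w ++ q.2) (Primrec.const []) (list_append.comp fst (snd.comp snd))).of_eq ?_
  intro w n
  induction n with
  | zero => rfl
  | succ n ih => exact congrArg (w ++ ·) ih

theorem primrec_wordInv : Primrec wordInv :=
  list_reverse.comp (list_map Primrec.id
    (pair (fst.comp snd) (Primrec.not.comp (snd.comp snd))))

theorem primrec_wordConj : Primrec₂ wordConj :=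
  list_append.comp (primrec_wordInv.comp fst) (list_append.comp snd fst)

theorem primrec_deltaLetter (b : Bool) :
    Primrec fun T : List (ℕ × ℕ × ℕ) => ([(deltaIndex T, b)] : Word) :=
  list_cons.comp (pair primrec_deltaIndex (Primrec.const b)) (Primrec.const [])

theorem primrecRel_isPos : PrimrecRel IsPos := by
  have hlen : Primrec fun q : List (ℕ × ℕ × ℕ) × Word => q.2.length := list_length.comp snd
  have hpow : ∀ b, Primrec fun q : List (ℕ × ℕ × ℕ) × Word =>
      wordPow [(deltaIndex q.1, b)] q.2.length := fun b =>
    primrec_wordPow.comp ((primrec_deltaLetter b).comp fst) hlen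
  have h := primrec_act.comp (pair fst (pair (hpow false) (primrec_act.comp (pair fst
    (pair snd (primrec_act.comp (pair fst (pair (hpow true) (Primrec.const [[]])))))))))
  exact (Primrec.eq.comp h (Primrec.const [])).not

attribute [local irreducible] IsPos

theorem primrec_letters : Primrec letters :=
  list_flatMap Primrec.id (list_cons.comp (pair (fst.comp snd) (Primrec.const true))
    (list_cons.comp (pair (fst.comp snd) (Primrec.const false)) (Primrec.const [])))

theorem primrec_words : Primrec₂ words := by
  refine (nat_rec (f := fun _ : List (ℕ × Bool) => ([[]] : List Word))
    (g := fun A q => q.2.flatMap fun p => A.map fun a => a :: p) (Primrec.const [[]])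
    (list_flatMap (snd.comp snd) (list_map (fst.comp fst)
      (list_cons.comp snd (snd.comp fst))))).of_eq ?_
  intro A n
  induction n with
  | zero => rfl
  | succ n ih => exact congrArg (fun l : List Word => l.flatMap fun p => A.map fun a => a :: p) ih

theorem primrec_deltaWord : Primrec fun q : List (ℕ × ℕ × ℕ) × ℕ × ℕ =>
    deltaWord q.1 q.2.1 q.2.2 :=
  list_append.comp
    (primrec_wordPow.comp ((primrec_deltaLetter false).comp fst) (fst.comp snd))
    (primrec_wordPow.comp ((primrec_deltaLetter true).comp fst) (snd.comp snd))

theorem primrecPred_imp {α : Type*} [Primcodable α] {p q : α → Prop} (hp : PrimrecPred p)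
    (hq : PrimrecPred q) : PrimrecPred fun a => p a → q a :=
  (hp.not.or hq).of_eq fun _ => imp_iff_not_or.symm

theorem primrecRel_forall_lt {α β : Type*} [Primcodable α] [Primcodable β] {R : ℕ → β → Prop}
    (hR : PrimrecRel R) {f : α → ℕ} {g : α → β} (hf : Primrec f) (hg : Primrec g) :
    PrimrecPred fun a => ∀ n < f a, R n (g a) :=
  (hR.forall_mem_list.comp (list_range.comp hf) hg).of_eq fun _ => by simp

theorem primrecPred_isSummit :
    PrimrecPred fun q : (List (ℕ × ℕ × ℕ) × List Word × ℕ) × Word × Word =>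
      IsSummit q.1.1 q.1.2.1 q.1.2.2 q.2.1 q.2.2 := by
  have hd : Primrec fun q : ℕ × Word × (List (ℕ × ℕ × ℕ) × List Word × ℕ) × Word × Word =>
      deltaWord q.2.2.1.1 q.2.2.1.2.2 q.1 :=
    primrec_deltaWord.comp (pair (fst.comp (fst.comp (snd.comp snd)))
      (pair (snd.comp (snd.comp (fst.comp (snd.comp snd)))) fst))
  have hT : Primrec fun q : ℕ × Word × (List (ℕ × ℕ × ℕ) × List Word × ℕ) × Word × Word =>
      q.2.2.1.1 := fst.comp (fst.comp (snd.comp snd))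
  have h0 : PrimrecRel fun (r : ℕ)
      (q : Word × (List (ℕ × ℕ × ℕ) × List Word × ℕ) × Word × Word) =>
      IsPos q.2.1.1 (deltaWord q.2.1.1 q.2.1.2.2 r ++ wordConj q.1 q.2.2.1) →
        IsPos q.2.1.1 (deltaWord q.2.1.1 q.2.1.2.2 r ++ q.2.2.2) :=
    primrecPred_imp
      (primrecRel_isPos.comp hT (list_append.comp hd (primrec_wordConj.comp (fst.comp snd)
        (fst.comp (snd.comp (snd.comp snd))))))
      (primrecRel_isPos.comp hT (list_append.comp hd (snd.comp (snd.comp (snd.comp snd)))))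
  have h1 : PrimrecRel fun (c : Word)
      (q : (List (ℕ × ℕ × ℕ) × List Word × ℕ) × Word × Word) =>
      ∀ r < 2 * q.1.2.2 + 1, IsPos q.1.1 (deltaWord q.1.1 q.1.2.2 r ++ wordConj c q.2.1) →
        IsPos q.1.1 (deltaWord q.1.1 q.1.2.2 r ++ q.2.2) :=
    primrecRel_forall_lt h0
      (nat_double_succ.comp (snd.comp (snd.comp (fst.comp snd)))) Primrec.id
  exact h1.forall_mem_list.comp (fst.comp (snd.comp fst)) Primrec.id

theorem primrecPred_isStable :
    PrimrecPred fun q : (List (ℕ × ℕ × ℕ) × List Word × ℕ) × Word × Word =>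
      IsStable q.1.1 q.1.2.1 q.1.2.2 q.2.1 q.2.2 := by
  have h0 : PrimrecRel fun (n : ℕ)
      (q : (List (ℕ × ℕ × ℕ) × List Word × ℕ) × Word × Word) =>
      IsSummit q.1.1 q.1.2.1 q.1.2.2 (wordPow q.2.1 (n + 1)) (wordPow q.2.2 (n + 1)) ∧
        IsSummit q.1.1 q.1.2.1 q.1.2.2 (wordPow (wordInv q.2.1) (n + 1))
          (wordPow (wordInv q.2.2) (n + 1)) := by
    have hw : Primrec fun q : ℕ × (List (ℕ × ℕ × ℕ) × List Word × ℕ) × Word × Word =>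
        q.2.2.1 := fst.comp (snd.comp snd)
    have hv : Primrec fun q : ℕ × (List (ℕ × ℕ × ℕ) × List Word × ℕ) × Word × Word =>
        q.2.2.2 := snd.comp (snd.comp snd)
    have hn : Primrec fun q : ℕ × (List (ℕ × ℕ × ℕ) × List Word × ℕ) × Word × Word =>
        q.1 + 1 := Primrec.succ.comp fst
    exact (primrecPred_isSummit.comp (pair (fst.comp snd)
        (pair (primrec_wordPow.comp hw hn) (primrec_wordPow.comp hv hn)))).and
      (primrecPred_isSummit.comp (pair (fst.comp snd)
        (pair (primrec_wordPow.comp (primrec_wordInv.comp hw) hn)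
          (primrec_wordPow.comp (primrec_wordInv.comp hv) hn))))
  exact primrecRel_forall_lt h0 (list_length.comp (fst.comp fst)) Primrec.id

theorem primrec_dedupWords : Primrec₂ dedupWords := by
  have h0 : PrimrecRel fun (u : Word) (q : List (ℕ × ℕ × ℕ) × Word) =>
      IsPos q.1 (wordInv u ++ q.2) ∧ IsPos q.1 (wordInv q.2 ++ u) :=
    (primrecRel_isPos.comp (fst.comp snd)
      (list_append.comp (primrec_wordInv.comp fst) (snd.comp snd))).and
    (primrecRel_isPos.comp (fst.comp snd)
      (list_append.comp (primrec_wordInv.comp (snd.comp snd)) fst))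
  have hc : PrimrecPred fun p : (List (ℕ × ℕ × ℕ) × List Word) × (Word × List Word) =>
      ∃ u ∈ p.2.2, IsPos p.1.1 (wordInv u ++ p.2.1) ∧ IsPos p.1.1 (wordInv p.2.1 ++ u) :=
    h0.exists_mem_list.comp (snd.comp snd) (pair (fst.comp fst) (fst.comp snd))
  have h1 : Primrec₂ fun (q : List (ℕ × ℕ × ℕ) × List Word) (b : Word × List Word) =>
      if ∃ u ∈ b.2, IsPos q.1 (wordInv u ++ b.1) ∧ IsPos q.1 (wordInv b.1 ++ u) then b.2
      else b.1 :: b.2 :=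
    Primrec.ite hc
      (snd.comp snd) (list_cons.comp (fst.comp snd) (snd.comp snd))
  exact list_foldr snd (Primrec.const []) h1

theorem primrec_boundExponent : Primrec₂ boundExponent :=
  nat_mul.comp (list_length.comp fst) (list_length.comp snd)

theorem primrec_conjugators : Primrec₂ conjugators :=
  primrec_words.comp (primrec_letters.comp fst) (list_length.comp
    (primrec_words.comp (primrec_letters.comp fst) (nat_double.comp snd)))

theorem primrec_stableSummitWords : Primrec₂ stableSummitWords := by
  have hW : Primrec fun q : List (ℕ × ℕ × ℕ) × Word =>
      conjugators q.1 (boundExponent q.1 q.2) :=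
    primrec_conjugators.comp fst (primrec_boundExponent.comp fst snd)
  have h0 : PrimrecRel fun (v : Word) (q : List (ℕ × ℕ × ℕ) × Word) =>
      IsStable q.1 (conjugators q.1 (boundExponent q.1 q.2)) (boundExponent q.1 q.2) q.2 v :=
    primrecPred_isStable.comp (pair
      (pair (fst.comp snd) (pair (hW.comp snd) (primrec_boundExponent.comp (fst.comp snd) (snd.comp snd))))
      (pair (snd.comp snd) fst))
  exact primrec_dedupWords.comp fst (h0.listFilter.comp
    (list_map hW (primrec_wordConj.comp snd (snd.comp fst))) Primrec.id)

end Primrec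

end Garside

/-- There is one algorithm (a partial recursive function `A`) for all Garside groups. Given the
multiplication table `T` of the simple elements and a word `w` that represents `g`, it halts and
returns a list of words which represent the elements of `[g]^St`, each of them once. -/
theorem corollary6p3 :
    ∃ A : List (ℕ × ℕ × ℕ) × Garside.Word →. List Garside.Word,
      Partrec A ∧
      ∀ (G : Type*) [Group G] (P : Submonoid G) (Δ : P), Garside.IsGarsideGroup P Δ →
      ∀ s : List G, Garside.IsSimpleEnumeration P Δ s →
      ∀ T : List (ℕ × ℕ × ℕ), Garside.IsProductTable s T →
      ∀ (g : G) (w : Garside.Word), Garside.IsWordOver s w → Garside.wordEval s w = g →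
        ∃ L : List Garside.Word, L ∈ A (T, w) ∧
          (∀ v ∈ L, Garside.IsWordOver s v) ∧
          (L.map (Garside.wordEval s)).Nodup ∧
          {h : G | h ∈ L.map (Garside.wordEval s)} = Garside.stableSuperSummitSet P Δ g := by
  refine ⟨fun q => Part.some (Garside.stableSummitWords q.1 q.2),
    Garside.primrec_stableSummitWords.to_comp.partrec, ?_⟩
  intro G _ P Δ hG s hs T hT g w hw hg
  subst hg
  exact ⟨_, Part.mem_some _, Garside.stableSummitWords_spec hG hs hT hw⟩
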